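/- Let $n\ge 2$, $0\le\alpha<1$, $\mu\ge 0$, $R>0$, and set $$p_G'=p_G'(n,\alpha,\mu)=1+\frac{2}{(1-\alpha)(n-1)+\mu+\alpha},\qquad p_0=p_0(n,\alpha,\mu)=1+\frac{1}{n(1-\alpha)+\mu}.$$ Let $p>1$ satisfy $p\le p_G'$ or $p<p_0$. Let $u_0\in C^2(\mathbb R^n)$ and $u_1\in C^1(\mathbb R^n)$ be real-valued and not both identically zero, with $u_1(x)\ge u_0(x)\ge 0$ for all $x$ and $\operatorname{supp}u_0,\operatorname{supp}u_1\subset\{|x|\le R\}$. For $\varepsilon>0$ consider the Cauchy problem $$u_{tt}-\frac1{t^{2\alpha}}\Delta u+\frac{\mu}{t}u_t=|u_t|^p\quad (t>1,\ x\in\mathbb R^n),\qquad u(1,x)=\varepsilon u_0(x),\quad u_t(1,x)=\varepsilon u_1(x).$$ For $1<T\le\infty$, a classical solution on $[1,T)$ is a real-valued $u\in C^2([1,T)\times\mathbb R^n)$ satisfying the equation for $1<t<T$ and the initial conditions. Let $T_\varepsilon\in[-\infty,\infty]$ be the supremum of all $T\in(1,\infty]$ such that a classical solution on $[1,T)$ exists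 (with $\sup\emptyset=-\infty$). Then, for every $\varepsilon>0$, if a classical solution on $[1,T)$ exists, then $T<\infty$. Moreover, there are constants $\varepsilon_0>0$ and $C>0$, depending only on $n,p,\alpha,\mu,R,u_0,u_1$ (in particular $C$ is independent of $\varepsilon$), such that for all $0<\varepsilon\le\varepsilon_0$ $$T_\varepsilon\le C\,\varepsilon^{\frac{-(p-1)}{1-\{(1-\alpha)(n-1)+\mu+\alpha\}(p-1)/2}}\quad\text{if } p<p_G',$$ $$T_\varepsilon\le \exp\bigl(C\varepsilon^{-(p-1)}\bigr)\quad\text{if } p=p_G',$$ $$T_\varepsilon\le C\,\varepsilon^{\frac{-(p-1)}{1-(p-1)\{n(1-\alpha)+\mu\}}}\quad\text{if } p<p_0.$$ -/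

import Mathlib

namespace Glassey

/-- Space `ℝⁿ` with the Euclidean norm. -/
abbrev Space (n : ℕ) : Type := EuclideanSpace ℝ (Fin n)

/-- The exponent `p_G'(n, α, μ) = 1 + 2 / ((1 - α)(n - 1) + μ + α)`. -/
noncomputable def pG (n : ℕ) (α μ : ℝ) : ℝ :=
  1 + 2 / ((1 - α) * ((n : ℝ) - 1) + μ + α)

/-- The exponent `p₀(n, α, μ) = 1 + 1 / (n (1 - α) + μ)`. -/
noncomputable def p0 (n : ℕ) (α μ : ℝ) : ℝ :=
  1 + 1 / ((n : ℝ) * (1 - α) + μ)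

/-- The time interval `[1, T)`, where `T = ⊤` is allowed. -/
def timeInterval (T : EReal) : Set ℝ := {t : ℝ | 1 ≤ t ∧ (t : EReal) < T}

/-- `u` is a classical solution, of class `C²` on `[1, T) × ℝⁿ` (up to the initial time), of
`u_tt - t^(-2α) Δu + (μ / t) u_t = |u_t|^p` with `u(1, x) = ε u₀(x)`, `u_t(1, x) = ε u₁(x)`.
The values of `u` outside `[1, T) × ℝⁿ` play no role. -/
structure IsClassicalSolution {n : ℕ} (α μ p : ℝ) (u₀ u₁ : Space n → ℝ) (ε : ℝ)
    (T : EReal) (u : ℝ → Space n → ℝ) : Prop where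
  one_lt : 1 < T
  contDiffOn : ContDiffOn ℝ 2 (fun z : ℝ × Space n => u z.1 z.2) (timeInterval T ×ˢ Set.univ)
  equation : ∀ t : ℝ, 1 < t → (t : EReal) < T → ∀ x : Space n,
    iteratedDeriv 2 (fun s => u s x) t - 1 / t ^ (2 * α) * Laplacian.laplacian (u t) x
      + μ / t * deriv (fun s => u s x) t = |deriv (fun s => u s x) t| ^ p
  initial_value : ∀ x : Space n, u 1 x = ε * u₀ x
  initial_velocity : ∀ x : Space n,
    HasDerivWithinAt (fun s => u s x) (ε * u₁ x) (Set.Ici 1) 1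

/-- The lifespan `T_ε`: the supremum, in the extended reals, of all `T` such that a classical
solution exists on `[1, T) × ℝⁿ`. -/
noncomputable def lifespan {n : ℕ} (α μ p : ℝ) (u₀ u₁ : Space n → ℝ) (ε : ℝ) : EReal :=
  sSup {T : EReal | ∃ u : ℝ → Space n → ℝ, IsClassicalSolution α μ p u₀ u₁ ε T u}

end Glassey

/-! The equation is reduced to scalar differential inequalities for moments of `u` against the
weight `φ = exp (κ xᵢ)`, with `κ = 1` or `κ = 0`. Finite propagation speed confines `u(t)` to the
ball of radius `R + A(t)`, where `A(t) = ∫₁ᵗ s^(-α) ds`, so integration by parts is free of boundary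
terms. Since `Δφ = κ² φ`, the moments `U = ∫ u φ`, `V = ∫ u_t φ`, `N = ∫ |u_t|^p φ` satisfy `U' = V`
and `V' = κ² t^(-2α) U - (μ/t) V + N`. Hölder gives `|V|^p ≤ N Φ^(p-1)`, with `Φ` the mass of `φ` on
that ball (`SolutionJet.moment_ode`).

For `κ = 1`, take a supersolution `k` (`rate`) of the Riccati equation `k' + (μ/t) k - k² + t^(-2α)
= 0` and a multiplier `m` with `m'/m = μ/t - k`. Then `(m (V + k U))' ≥ m N`, so `m (V + k U)`
dominates `H = V(1) + ∫ m N`. A second comparison removes `U` and leaves `m V ≥ c H`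
(`velocity_moment_lower_bound`). Hence `H' = m N ≥ (m V)^p (m Φ)^(1-p) ≥ c^p H^p (m Φ)^(1-p)`. The
factor `exp (-A)` in `m` cancels the exponential growth of `Φ`, so `m Φ` is at most of order
`t^(((1-α)(n-1)+μ+α)/2)`. The result is `H' ≥ K H^p t^(-σ)` with `σ = ((1-α)(n-1)+μ+α)(p-1)/2`.
Integration bounds `∫₁ᵗ s^(-σ) ds` by a multiple of `H(1)^(1-p)`, itself a multiple of `ε^(1-p)`.
The integral diverges as `t → ∞` exactly when `σ ≤ 1`, i.e. `p ≤ p_G'`, logarithmically at equality.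

For `κ = 0`, the function `t^μ V` plays the role of `H`, and `Φ` is a volume of order at most
`t^(n(1-α))`. The exponent becomes `(p-1)(n(1-α)+μ)`, which is below `1` when `p < p₀`. -/

namespace Glassey

open MeasureTheory Set Filter Topology Function

/-! ### Derivatives of a classical solution up to the initial time -/

/-- The space-time slab `[1, T) × ℝⁿ`. -/
def slab (n : ℕ) (T : EReal) : Set (ℝ × Space n) := timeInterval T ×ˢ Set.univ

/-- The `i`-th standard basis vector of `ℝⁿ`. -/
noncomputable abbrev basisVec {n : ℕ} (i : Fin n) : Space n := EuclideanSpace.single i 1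

/-- The first and second order partial derivatives of a classical solution, together with the
identities relating them. -/
structure SolutionJet {n : ℕ} (α μ p : ℝ) (u₀ u₁ : Space n → ℝ) (ε : ℝ) (T : EReal)
    (u ut utt : ℝ → Space n → ℝ) (g gt gx : Fin n → ℝ → Space n → ℝ) : Prop where
  one_lt : 1 < T
  cont_u : ContinuousOn (uncurry u) (slab n T)
  cont_ut : ContinuousOn (uncurry ut) (slab n T)
  cont_utt : ContinuousOn (uncurry utt) (slab n T)
  cont_g : ∀ i, ContinuousOn (uncurry (g i)) (slab n T)
  cont_gt : ∀ i, ContinuousOn (uncurry (gt i)) (slab n T)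
  cont_gx : ∀ i, ContinuousOn (uncurry (gx i)) (slab n T)
  deriv_u : ∀ t : ℝ, 1 < t → (t : EReal) < T → ∀ x, HasDerivAt (fun s => u s x) (ut t x) t
  deriv_ut : ∀ t : ℝ, 1 < t → (t : EReal) < T → ∀ x, HasDerivAt (fun s => ut s x) (utt t x) t
  deriv_g : ∀ i, ∀ t : ℝ, 1 < t → (t : EReal) < T → ∀ x,
    HasDerivAt (fun s => g i s x) (gt i t x) t
  lineDeriv_u : ∀ i, ∀ t : ℝ, 1 < t → (t : EReal) < T → ∀ x,
    HasLineDerivAt ℝ (u t) (g i t x) x (basisVec i)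
  lineDeriv_ut : ∀ i, ∀ t : ℝ, 1 < t → (t : EReal) < T → ∀ x,
    HasLineDerivAt ℝ (ut t) (gt i t x) x (basisVec i)
  lineDeriv_g : ∀ i, ∀ t : ℝ, 1 < t → (t : EReal) < T → ∀ x,
    HasLineDerivAt ℝ (g i t) (gx i t x) x (basisVec i)
  equation : ∀ t : ℝ, 1 < t → (t : EReal) < T → ∀ x,
    utt t x = 1 / t ^ (2 * α) * ∑ i, gx i t x - μ / t * ut t x + |ut t x| ^ p
  initial_u : ∀ x, u 1 x = ε * u₀ x
  initial_ut : ∀ x, ut 1 x = ε * u₁ x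
  initial_g : ∀ i x, HasLineDerivAt ℝ (fun y => ε * u₀ y) (g i 1 x) x (basisVec i)

lemma convex_timeInterval (T : EReal) : Convex ℝ (timeInterval T) := by
  apply Set.OrdConnected.convex
  refine ⟨fun a ha b hb c hc => ⟨ha.1.trans hc.1, lt_of_le_of_lt ?_ hb.2⟩⟩
  exact_mod_cast hc.2

lemma timeInterval_mem_nhds {T : EReal} {t : ℝ} (h1 : 1 < t) (h2 : (t : EReal) < T) :
    timeInterval T ∈ 𝓝 t := by
  have ho : IsOpen {s : ℝ | (s : EReal) < T} :=
    isOpen_Iio.preimage continuous_coe_real_ereal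
  filter_upwards [Ioi_mem_nhds h1, ho.mem_nhds h2] with s hs hs'
  exact ⟨le_of_lt hs, hs'⟩

lemma slab_mem_nhds {n : ℕ} {T : EReal} {t : ℝ} (h1 : 1 < t) (h2 : (t : EReal) < T)
    (x : Space n) : slab n T ∈ 𝓝 (t, x) :=
  prod_mem_nhds (timeInterval_mem_nhds h1 h2) univ_mem

lemma exists_between_one {T : EReal} (hT : 1 < T) : ∃ t : ℝ, 1 < t ∧ (t : EReal) < T := by
  obtain ⟨t, h1, h2⟩ := EReal.lt_iff_exists_real_btwn.1 hT
  exact ⟨t, by exact_mod_cast h1, h2⟩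

lemma uniqueDiffOn_slab (n : ℕ) {T : EReal} (hT : 1 < T) : UniqueDiffOn ℝ (slab n T) := by
  refine UniqueDiffOn.prod ?_ uniqueDiffOn_univ
  obtain ⟨t, h1, h2⟩ := exists_between_one hT
  exact uniqueDiffOn_convex (convex_timeInterval T)
    ⟨t, mem_interior_iff_mem_nhds.2 (timeInterval_mem_nhds h1 h2)⟩

lemma laplacian_eq_sum {n : ℕ} (f : Space n → ℝ) (x : Space n) :
    Laplacian.laplacian f x = ∑ i, fderiv ℝ (fderiv ℝ f) x (basisVec i) (basisVec i) := by
  rw [InnerProductSpace.laplacian_eq_iteratedFDeriv_orthonormalBasis f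
    (EuclideanSpace.basisFun (Fin n) ℝ)]
  simp [iteratedFDeriv_two_apply]

/-- All derivatives are read off from `fderivWithin` on the slab, a convex set with nonempty
interior, hence of unique differentiability. They are therefore continuous down to `t = 1`, where
the energy and moment arguments start, and agree with ordinary derivatives for `t > 1`. -/
theorem IsClassicalSolution.exists_jet {n : ℕ} {α μ p : ℝ} {u₀ u₁ : Space n → ℝ} {ε : ℝ}
    {T : EReal} {u : ℝ → Space n → ℝ} (h : IsClassicalSolution α μ p u₀ u₁ ε T u) :
    ∃ ut utt g gt gx, SolutionJet α μ p u₀ u₁ ε T u ut utt g gt gx := by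
  set f : ℝ × Space n → ℝ := fun z => u z.1 z.2 with hf
  set S := slab n T with hS
  have hU : UniqueDiffOn ℝ S := uniqueDiffOn_slab n h.one_lt
  have hc : ContDiffOn ℝ 2 f S := h.contDiffOn
  set F1 := fderivWithin ℝ f S with hF1
  have hc1 : ContDiffOn ℝ 1 F1 S := hc.fderivWithin hU (by norm_num)
  set F2 := fderivWithin ℝ F1 S with hF2
  have hc2 : ContinuousOn F2 S := hc1.continuousOn_fderivWithin hU (by norm_num)
  have hd1w : ∀ z ∈ S, HasFDerivWithinAt f (F1 z) S z := fun z hz =>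
    ((hc z hz).differentiableWithinAt (by norm_num)).hasFDerivWithinAt
  have hd2w : ∀ z ∈ S, HasFDerivWithinAt F1 (F2 z) S z := fun z hz =>
    ((hc1 z hz).differentiableWithinAt (by norm_num)).hasFDerivWithinAt
  have hmem : ∀ (t : ℝ), 1 < t → (t : EReal) < T → ∀ x, (t, x) ∈ S := fun t h1 h2 x =>
    mem_of_mem_nhds (slab_mem_nhds h1 h2 x)
  have hd1 : ∀ (t : ℝ), 1 < t → (t : EReal) < T → ∀ x, HasFDerivAt f (F1 (t, x)) (t, x) :=
    fun t h1 h2 x => (hd1w _ (hmem t h1 h2 x)).hasFDerivAt (slab_mem_nhds h1 h2 x)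
  have hd2 : ∀ (t : ℝ), 1 < t → (t : EReal) < T → ∀ x, HasFDerivAt F1 (F2 (t, x)) (t, x) :=
    fun t h1 h2 x => (hd2w _ (hmem t h1 h2 x)).hasFDerivAt (slab_mem_nhds h1 h2 x)
  have htime : ∀ (t : ℝ) (x : Space n),
      HasDerivAt (fun s : ℝ => (s, x)) ((1 : ℝ), (0 : Space n)) t := fun t x =>
    (hasDerivAt_id t).prodMk (hasDerivAt_const t x)
  have hspace : ∀ (t : ℝ) (x : Space n),
      HasFDerivAt (fun y : Space n => (t, y)) (ContinuousLinearMap.inr ℝ ℝ (Space n)) x :=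
    fun t x => hasFDerivAt_prodMk_right t x
  have hdu : ∀ t : ℝ, 1 < t → (t : EReal) < T → ∀ x,
      HasDerivAt (fun s => u s x) (F1 (t, x) (1, 0)) t := fun t h1 h2 x => by
    have := (hd1 t h1 h2 x).comp_hasDerivAt t (htime t x)
    exact this
  have hdut : ∀ t : ℝ, 1 < t → (t : EReal) < T → ∀ x w,
      HasDerivAt (fun s => F1 (s, x) w) (F2 (t, x) (1, 0) w) t := fun t h1 h2 x w => by
    have := (hd2 t h1 h2 x).comp_hasDerivAt t (htime t x)
    simpa using this.clm_apply (hasDerivAt_const t w)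
  have hdx : ∀ t : ℝ, 1 < t → (t : EReal) < T → ∀ x,
      HasFDerivAt (u t) ((F1 (t, x)).comp (ContinuousLinearMap.inr ℝ ℝ (Space n))) x :=
    fun t h1 h2 x => (hd1 t h1 h2 x).comp x (hspace t x)
  have hdF1x : ∀ t : ℝ, 1 < t → (t : EReal) < T → ∀ x,
      HasFDerivAt (fun y => F1 (t, y))
        ((F2 (t, x)).comp (ContinuousLinearMap.inr ℝ ℝ (Space n))) x :=
    fun t h1 h2 x => (hd2 t h1 h2 x).comp x (hspace t x)
  have hlF1 : ∀ t : ℝ, 1 < t → (t : EReal) < T → ∀ x w v,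
      HasLineDerivAt ℝ (fun y => F1 (t, y) w) (F2 (t, x) (0, v) w) x v :=
    fun t h1 h2 x w v => by
    have := (hdF1x t h1 h2 x).clm_apply (hasFDerivAt_const w x)
    simpa using this.hasLineDerivAt v
  refine ⟨fun t x => F1 (t, x) (1, 0), fun t x => F2 (t, x) (1, 0) (1, 0),
    fun i t x => F1 (t, x) (0, basisVec i), fun i t x => F2 (t, x) (1, 0) (0, basisVec i),
    fun i t x => F2 (t, x) (0, basisVec i) (0, basisVec i), ?_⟩
  have key : ∀ t : ℝ, 1 < t → (t : EReal) < T → ∀ x,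
      F2 (t, x) (1, 0) (1, 0)
        = 1 / t ^ (2 * α) * ∑ i, F2 (t, x) (0, basisVec i) (0, basisVec i)
        - μ / t * F1 (t, x) (1, 0) + |F1 (t, x) (1, 0)| ^ p := by
    intro t h1 h2 x
    have e := h.equation t h1 h2 x
    have e1 : deriv (fun s => u s x) t = F1 (t, x) (1, 0) := (hdu t h1 h2 x).deriv
    have e2 : iteratedDeriv 2 (fun s => u s x) t = F2 (t, x) (1, 0) (1, 0) := by
      rw [iteratedDeriv_succ, iteratedDeriv_one]
      have : deriv (fun s => u s x) =ᶠ[𝓝 t] fun s => F1 (s, x) (1, 0) := by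
        have ho : IsOpen {s : ℝ | (s : EReal) < T} :=
          isOpen_Iio.preimage continuous_coe_real_ereal
        filter_upwards [Ioi_mem_nhds h1, ho.mem_nhds h2] with s hs hs'
        exact (hdu s hs hs' x).deriv
      rw [this.deriv_eq]
      exact (hdut t h1 h2 x (1, 0)).deriv
    have e3 : Laplacian.laplacian (u t) x
        = ∑ i, F2 (t, x) (0, basisVec i) (0, basisVec i) := by
      rw [laplacian_eq_sum]
      refine Finset.sum_congr rfl fun i _ => ?_
      have : fderiv ℝ (u t)
          = fun y => (F1 (t, y)).comp (ContinuousLinearMap.inr ℝ ℝ (Space n)) := by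
        ext1 y; exact (hdx t h1 h2 y).fderiv
      rw [this, ((hdF1x t h1 h2 x).clm_comp (hasFDerivAt_const _ x)).fderiv]
      simp
    rw [e1, e2, e3] at e
    linarith
  have hmem1 : ∀ x, ((1 : ℝ), x) ∈ S := fun x => ⟨⟨le_rfl, by exact_mod_cast h.one_lt⟩, mem_univ _⟩
  have ca : ∀ w, ContinuousOn (fun z => F1 z w) S := fun w =>
    hc1.continuousOn.clm_apply continuousOn_const
  have cb : ∀ w w', ContinuousOn (fun z => F2 z w w') S := fun w w' =>
    (hc2.clm_apply continuousOn_const).clm_apply continuousOn_const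
  refine ⟨h.one_lt, hc.continuousOn, ca _, cb _ _, fun i => ca _, fun i => cb _ _,
    fun i => cb _ _, hdu, fun t h1 h2 x => hdut t h1 h2 x _, fun i t h1 h2 x => hdut t h1 h2 x _,
    fun i t h1 h2 x => ?_, fun i t h1 h2 x => ?_, fun i t h1 h2 x => hlF1 t h1 h2 x _ _, key,
    h.initial_value, fun x => ?_, fun i x => ?_⟩
  · simpa using (hdx t h1 h2 x).hasLineDerivAt (basisVec i)
  -- A single function `gt i` has to serve as both `∂ₜ∂ᵢu` and `∂ᵢ∂ₜu`; this is the symmetry of the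
  -- second derivative.
  · have sym : F2 (t, x) (1, 0) (0, basisVec i) = F2 (t, x) (0, basisVec i) (1, 0) := by
      refine second_derivative_symmetric_of_eventually (f := f) (f' := F1) ?_ (hd2 t h1 h2 x) _ _
      have : interior S ∈ 𝓝 (t, x) := interior_mem_nhds.2 (slab_mem_nhds h1 h2 x)
      filter_upwards [this] with z hz
      exact (hd1w z (interior_subset hz)).hasFDerivAt (mem_interior_iff_mem_nhds.1 hz)
    simpa only [sym] using hlF1 t h1 h2 x (1, 0) (basisVec i)
  -- At `t = 1` both derivatives are one-sided; uniqueness of derivatives within `[1, s]` identifies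
  -- them.
  · obtain ⟨s, hs1, hs2⟩ := exists_between_one h.one_lt
    have hmaps : MapsTo (fun r : ℝ => (r, x)) (Icc 1 s) S := fun r hr =>
      ⟨⟨hr.1, lt_of_le_of_lt (by exact_mod_cast hr.2) hs2⟩, mem_univ _⟩
    have d1 : HasDerivWithinAt (fun s => u s x) (F1 (1, x) (1, 0)) (Icc 1 s) 1 := by
      have := (hd1w _ (hmem1 x)).comp_hasDerivWithinAt 1 (htime 1 x).hasDerivWithinAt hmaps
      exact this
    have d2 : HasDerivWithinAt (fun s => u s x) (ε * u₁ x) (Icc 1 s) 1 :=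
      (h.initial_velocity x).mono Icc_subset_Ici_self
    exact (uniqueDiffOn_Icc hs1 1 (left_mem_Icc.2 hs1.le)).eq_deriv _ d1 d2
  · have d1 : HasFDerivWithinAt (fun y => u 1 y)
        ((F1 (1, x)).comp (ContinuousLinearMap.inr ℝ ℝ (Space n))) univ x :=
      (hd1w _ (hmem1 x)).comp x (hspace 1 x).hasFDerivWithinAt (fun y _ => hmem1 y)
    rw [hasFDerivWithinAt_univ] at d1
    have : (fun y => u 1 y) = fun y => ε * u₀ y := funext h.initial_value
    rw [this] at d1
    simpa using d1.hasLineDerivAt (basisVec i)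

/-! ### Integrals of compactly supported functions -/

section Calculus

variable {E : Type*} [NormedAddCommGroup E]

lemma integrable_of_continuous_of_zero_off [MeasurableSpace E] [BorelSpace E] {ν : Measure E}
    [IsFiniteMeasureOnCompacts ν] {f : E → ℝ} {k : Set E} (hk : IsCompact k)
    (hf : Continuous f) (h0 : ∀ x ∉ k, f x = 0) : Integrable f ν :=
  hf.integrable_of_hasCompactSupport (HasCompactSupport.intro hk h0)

lemma continuous_slice {X : Type*} [TopologicalSpace X] {F : ℝ → X → ℝ} {s : Set ℝ}
    (hF : ContinuousOn (uncurry F) (s ×ˢ univ)) {t : ℝ} (ht : t ∈ s) : Continuous (F t) := by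
  have : ContinuousOn (fun x : X => uncurry F (t, x)) univ :=
    hF.comp (by fun_prop) (fun x _ => ⟨ht, mem_univ _⟩)
  simpa [continuousOn_univ] using this

/-- Differentiation under the integral sign for uniformly compactly supported integrands. -/
lemma hasDerivAt_integral_of_compact_support [MeasurableSpace E] [BorelSpace E] {ν : Measure E}
    [IsFiniteMeasureOnCompacts ν] {F F' : ℝ → E → ℝ} {s : Set ℝ} {t : ℝ}
    (hs : s ∈ 𝓝 t) {k : Set E} (hk : IsCompact k)
    (hF : ContinuousOn (uncurry F) (s ×ˢ univ)) (hF' : ContinuousOn (uncurry F') (s ×ˢ univ))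
    (h0 : ∀ r ∈ s, ∀ x ∉ k, F r x = 0) (h0' : ∀ r ∈ s, ∀ x ∉ k, F' r x = 0)
    (hd : ∀ r ∈ s, ∀ x, HasDerivAt (fun r => F r x) (F' r x) r) :
    HasDerivAt (fun r => ∫ x, F r x ∂ν) (∫ x, F' t x ∂ν) t := by
  obtain ⟨δ, hδ, hsub⟩ := Metric.nhds_basis_closedBall.mem_iff.1 hs
  have hc : IsCompact (Metric.closedBall t δ ×ˢ k) := (isCompact_closedBall t δ).prod hk
  obtain ⟨M, hM⟩ := hc.exists_bound_of_continuousOn (hF'.mono (prod_mono hsub (subset_univ k)))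
  have hb : Metric.closedBall t δ ∈ 𝓝 t := Metric.closedBall_mem_nhds t hδ
  refine (hasDerivAt_integral_of_dominated_loc_of_deriv_le (bound := k.indicator fun _ => M) hb
    ?_ ?_ ?_ ?_ ?_ ?_).2
  · filter_upwards [hs] with r hr
    exact (continuous_slice hF hr).aestronglyMeasurable
  · exact integrable_of_continuous_of_zero_off hk (continuous_slice hF (mem_of_mem_nhds hs))
      (h0 t (mem_of_mem_nhds hs))
  · exact (continuous_slice hF' (mem_of_mem_nhds hs)).aestronglyMeasurable
  · refine Eventually.of_forall fun x r hr => ?_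
    by_cases hx : x ∈ k
    · simpa [hx] using hM (r, x) ⟨hr, hx⟩
    · simp [hx, h0' r (hsub hr) x hx]
  · exact (integrable_indicator_iff hk.measurableSet).2
      (integrableOn_const hk.measure_lt_top.ne)
  · exact Eventually.of_forall fun x r hr => hd r (hsub hr) x

lemma eq_zero_of_integral_eq_zero [MeasurableSpace E] [BorelSpace E] {ν : Measure E}
    [IsFiniteMeasureOnCompacts ν] [ν.IsOpenPosMeasure] {f : E → ℝ} {k : Set E} (hk : IsCompact k) (hf : Continuous f)
    (h0 : ∀ x ∉ k, f x = 0) (hpos : ∀ x, 0 ≤ f x) (h : ∫ x, f x ∂ν = 0) (x : E) : f x = 0 := by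
  have h1 := (integral_eq_zero_iff_of_nonneg hpos
    (integrable_of_continuous_of_zero_off hk hf h0)).1 h
  have := (hf.ae_eq_iff_eq ν continuous_const).1 h1
  exact congrFun this x

variable [NormedSpace ℝ E]

lemma hasLineDerivAt_mul {f g : E → ℝ} {f' g' : ℝ} {x v : E} (hf : HasLineDerivAt ℝ f f' x v)
    (hg : HasLineDerivAt ℝ g g' x v) :
    HasLineDerivAt ℝ (fun y => f y * g y) (f' * g x + f x * g') x v := by
  have := HasDerivAt.mul hf hg
  simpa [HasLineDerivAt, Pi.mul_def] using this

variable [FiniteDimensional ℝ E] [MeasurableSpace E] [BorelSpace E] {ν : Measure E}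
  [ν.IsAddHaarMeasure]

/-- The integral of a directional derivative of a compactly supported function vanishes. -/
lemma integral_lineDeriv_eq_zero {f f' : E → ℝ} {v : E} {k : Set E} (hk : IsCompact k)
    (hf : Continuous f) (hf' : Continuous f') (h0 : ∀ x ∉ k, f x = 0) (h0' : ∀ x ∉ k, f' x = 0)
    (hd : ∀ x, HasLineDerivAt ℝ f (f' x) x v) : ∫ x, f' x ∂ν = 0 := by
  -- Integration by parts against the constant function `1`.
  have := integral_bilinear_hasLineDerivAt_right_eq_neg_left_of_integrable (μ := ν)
    (f := fun _ => (1 : ℝ)) (f' := fun _ => (0 : ℝ)) (g := f) (g' := f') (v := v)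
    (B := ContinuousLinearMap.mul ℝ ℝ) (by simp)
    (by simpa using integrable_of_continuous_of_zero_off hk hf' h0')
    (by simpa using integrable_of_continuous_of_zero_off hk hf h0)
    (fun x _ => by simpa using (hasFDerivAt_const (1 : ℝ) x).hasLineDerivAt v)
    (fun x _ => hd x)
  simpa using this

end Calculus

/-! ### Light cones and their cut-off functions -/

/-- Squaring removes the corner of `max s 0`, so a squared cone depth is a differentiable weight and
the energy identity has no boundary term on the cone. -/
lemma hasDerivAt_max_sq (s : ℝ) : HasDerivAt (fun s : ℝ => max s 0 ^ 2) (2 * max s 0) s := by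
  rcases lt_trichotomy s 0 with h | rfl | h
  · have : (fun s : ℝ => max s 0 ^ 2) =ᶠ[𝓝 s] fun _ => 0 := by
      filter_upwards [Iio_mem_nhds h] with r hr
      simp [max_eq_right (mem_Iio.1 hr).le]
    rw [max_eq_right h.le]
    simpa using (hasDerivAt_const s (0 : ℝ)).congr_of_eventuallyEq this
  · rw [hasDerivAt_iff_isLittleO_nhds_zero]
    have h1 : (fun h : ℝ => h ^ 2) =o[𝓝 0] fun h => h := by
      simpa using Asymptotics.isLittleO_pow_pow (𝕜 := ℝ) (m := 1) (n := 2) (by norm_num)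
    refine Asymptotics.IsBigO.trans_isLittleO (Asymptotics.isBigO_of_le _ fun h => ?_) h1
    have h2 : |max h 0| ≤ |h| := by
      rcases le_total h 0 with h' | h' <;> simp [h']
    simpa using pow_le_pow_left₀ (abs_nonneg _) h2 2
  · have : (fun s : ℝ => max s 0 ^ 2) =ᶠ[𝓝 s] fun s => s ^ 2 := by
      filter_upwards [Ioi_mem_nhds h] with r hr
      rw [max_eq_left (mem_Ioi.1 hr).le]
    rw [max_eq_left h.le]
    simpa using (hasDerivAt_pow 2 s).congr_of_eventuallyEq this

/-- The distance `∫₁ᵗ s^(-α) ds` travelled by light between the times `1` and `t`. -/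
noncomputable def lightDist (α t : ℝ) : ℝ := (t ^ (1 - α) - 1) / (1 - α)

lemma lightDist_one (α : ℝ) : lightDist α 1 = 0 := by simp [lightDist]

lemma hasDerivAt_lightDist {α t : ℝ} (hα : α ≠ 1) (ht : 0 < t) :
    HasDerivAt (lightDist α) (t ^ (-α)) t := by
  have h := ((Real.hasDerivAt_rpow_const (p := 1 - α) (Or.inl ht.ne')).sub_const 1).div_const
    (1 - α)
  refine (h.congr_deriv ?_)
  have : 1 - α ≠ 0 := sub_ne_zero.2 hα.symm
  field_simp
  congr 1; ring

lemma lightDist_mono {α s t : ℝ} (hα : α < 1) (hs : 0 ≤ s) (h : s ≤ t) :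
    lightDist α s ≤ lightDist α t := by
  unfold lightDist
  have : 0 < 1 - α := by linarith
  gcongr

lemma lightDist_nonneg {α t : ℝ} (hα : α < 1) (h : 1 ≤ t) : 0 ≤ lightDist α t := by
  simpa [lightDist_one] using lightDist_mono hα zero_le_one h

/-- A smooth function approximating the distance to `x₀`. -/
noncomputable def smoothDist {n : ℕ} (x₀ : Space n) (δ : ℝ) (x : Space n) : ℝ :=
  √(‖x - x₀‖ ^ 2 + δ ^ 2)

section SmoothDist
variable {n : ℕ} {x₀ : Space n} {δ : ℝ}

lemma smoothDist_pos (hδ : 0 < δ) (x : Space n) : 0 < smoothDist x₀ δ x := by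
  unfold smoothDist; positivity

lemma norm_le_smoothDist (x : Space n) : ‖x - x₀‖ ≤ smoothDist x₀ δ x :=
  Real.le_sqrt_of_sq_le (by nlinarith [sq_nonneg δ])

lemma smoothDist_self (hδ : 0 < δ) : smoothDist x₀ δ x₀ = δ := by
  simp [smoothDist, Real.sqrt_sq hδ.le]

lemma continuous_smoothDist : Continuous (smoothDist x₀ δ) := by
  unfold smoothDist; fun_prop

lemma hasLineDerivAt_smoothDist (hδ : 0 < δ) (x : Space n) (i : Fin n) :
    HasLineDerivAt ℝ (smoothDist x₀ δ) ((x i - x₀ i) / smoothDist x₀ δ x) x (basisVec i) := by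
  have h1 : HasFDerivAt (fun x : Space n => ‖x - x₀‖ ^ 2 + δ ^ 2) _ x :=
    (((hasFDerivAt_id x).sub_const x₀).norm_sq).add_const (δ ^ 2)
  have hne : ‖x - x₀‖ ^ 2 + δ ^ 2 ≠ 0 := by positivity
  have h2 := (h1.sqrt hne).hasLineDerivAt (basisVec i)
  refine h2.congr_deriv ?_
  have := smoothDist_pos (x₀ := x₀) hδ x
  simp [smoothDist, EuclideanSpace.inner_single_right]
  field_simp

/-- The regularised distance has gradient of length at most `1`; this lets the shrinking of the cone
in time absorb the spatial energy flux. -/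
lemma sum_sq_smoothDist_le (hδ : 0 < δ) (x : Space n) :
    ∑ i, ((x i - x₀ i) / smoothDist x₀ δ x) ^ 2 ≤ 1 := by
  have h := smoothDist_pos (x₀ := x₀) hδ x
  simp_rw [div_pow]
  rw [← Finset.sum_div, div_le_one (by positivity)]
  have : smoothDist x₀ δ x ^ 2 = ‖x - x₀‖ ^ 2 + δ ^ 2 := by
    unfold smoothDist; rw [Real.sq_sqrt (by positivity)]
  rw [this, EuclideanSpace.norm_sq_eq]
  simp; positivity

end SmoothDist

lemma continuousOn_slab_fst {n : ℕ} {T : EReal} {f : ℝ → ℝ} (hf : ContinuousOn f (Ici 1)) :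
    ContinuousOn (fun z : ℝ × Space n => f z.1) (slab n T) :=
  hf.comp continuousOn_fst fun _ hz => hz.1.1

lemma continuousOn_rpow_Ici (a : ℝ) : ContinuousOn (fun t : ℝ => t ^ a) (Ici 1) :=
  continuousOn_id.rpow_const fun t ht => Or.inl (by simp at ht ⊢; linarith)

/-- The sum of squares appearing when completing the square in the energy flux. -/
lemma flux_nonneg {n : ℕ} (v s : ℝ) (g y : Fin n → ℝ) (hy : ∑ i, y i ^ 2 ≤ 1) :
    0 ≤ v ^ 2 + s ^ 2 * ∑ i, g i ^ 2 - 2 * (s * v * ∑ i, y i * g i) := by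
  have h : ∑ i, (s * g i - v * y i) ^ 2
      = s ^ 2 * ∑ i, g i ^ 2 - 2 * (s * v * ∑ i, y i * g i) + v ^ 2 * ∑ i, y i ^ 2 := by
    simp_rw [Finset.mul_sum, ← Finset.sum_sub_distrib, ← Finset.sum_add_distrib]
    exact Finset.sum_congr rfl fun i _ => by ring
  have h1 : 0 ≤ ∑ i, (s * g i - v * y i) ^ 2 := Finset.sum_nonneg fun i _ => sq_nonneg _
  nlinarith [sq_nonneg v]

/-- The cut-off depth `max (ρ - A(t) - ⟨x - x₀⟩) 0` inside a backward light cone. -/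
noncomputable def coneDepth {n : ℕ} (α ρ δ : ℝ) (x₀ : Space n) (t : ℝ) (x : Space n) : ℝ :=
  max (ρ - lightDist α t - smoothDist x₀ δ x) 0

section ConeDepth
variable {n : ℕ} {α ρ δ : ℝ} {x₀ : Space n}

lemma coneDepth_nonneg (t : ℝ) (x : Space n) : 0 ≤ coneDepth α ρ δ x₀ t x := le_max_right _ _

lemma coneDepth_eq_zero {t : ℝ} {x : Space n} (h : ρ ≤ lightDist α t + ‖x - x₀‖) :
    coneDepth α ρ δ x₀ t x = 0 :=
  max_eq_right (by linarith [norm_le_smoothDist (x₀ := x₀) (δ := δ) x])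

lemma coneDepth_pos_self (hδ : 0 < δ) {t : ℝ} (h : lightDist α t + δ < ρ) :
    0 < coneDepth α ρ δ x₀ t x₀ :=
  lt_max_of_lt_left (by rw [smoothDist_self hδ]; linarith)

lemma continuousOn_lightDist (α : ℝ) : ContinuousOn (lightDist α) (Ici 1) := by
  unfold lightDist
  exact ((continuousOn_rpow_Ici _).sub continuousOn_const).div_const _

lemma continuousOn_coneDepth {T : EReal} :
    ContinuousOn (uncurry (coneDepth α ρ δ x₀)) (slab n T) := by
  have h1 := continuousOn_slab_fst (n := n) (T := T) (continuousOn_lightDist α)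
  have h2 : ContinuousOn (fun z : ℝ × Space n => smoothDist x₀ δ z.2) (slab n T) :=
    (continuous_smoothDist.comp continuous_snd).continuousOn
  exact ContinuousOn.sup ((continuousOn_const.sub h1).sub h2) continuousOn_const

lemma hasDerivAt_coneDepth_sq (hα : α < 1) {t : ℝ} (ht : 0 < t) (x : Space n) :
    HasDerivAt (fun t => coneDepth α ρ δ x₀ t x ^ 2)
      (2 * coneDepth α ρ δ x₀ t x * (-t ^ (-α))) t := by
  have h := (((hasDerivAt_lightDist hα.ne ht).const_sub ρ).sub_const (smoothDist x₀ δ x))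
  exact (hasDerivAt_max_sq _).comp t h

lemma hasLineDerivAt_coneDepth_sq (hδ : 0 < δ) (t : ℝ) (x : Space n) (i : Fin n) :
    HasLineDerivAt ℝ (fun x => coneDepth α ρ δ x₀ t x ^ 2)
      (2 * coneDepth α ρ δ x₀ t x * (-((x i - x₀ i) / smoothDist x₀ δ x))) x (basisVec i) := by
  have h0 := hasLineDerivAt_smoothDist (x₀ := x₀) hδ x i
  have h : HasDerivAt (fun s : ℝ => ρ - lightDist α t - smoothDist x₀ δ (x + s • basisVec i))
      (-((x i - x₀ i) / smoothDist x₀ δ x)) 0 := HasDerivAt.const_sub (ρ - lightDist α t) h0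
  have h2 := hasDerivAt_max_sq (ρ - lightDist α t - smoothDist x₀ δ (x + (0:ℝ) • basisVec i))
  have := HasDerivAt.comp (0 : ℝ) h2 h
  simpa [HasLineDerivAt, coneDepth, Function.comp_def] using this

end ConeDepth

/-! ### Finite propagation speed by weighted energy -/

section FiniteSpeed

variable {n : ℕ} {α μ p R ε : ℝ} {u₀ u₁ : Space n → ℝ} {T : EReal}
  {u ut utt : ℝ → Space n → ℝ} {g gt gx : Fin n → ℝ → Space n → ℝ}

lemma initial_u_eq_zero (hs : tsupport u₀ ⊆ Metric.closedBall 0 R) {x : Space n} (hx : R < ‖x‖) :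
    u₀ x = 0 :=
  image_eq_zero_of_notMem_tsupport fun h => by
    have := hs h
    simp at this; linarith

lemma SolutionJet.initial_g_eq_zero (j : SolutionJet α μ p u₀ u₁ ε T u ut utt g gt gx)
    (hs : tsupport u₀ ⊆ Metric.closedBall 0 R) {x : Space n} (hx : R < ‖x‖) (i : Fin n) :
    g i 1 x = 0 := by
  have h1 : (fun y => ε * u₀ y) =ᶠ[𝓝 x] fun _ => (0 : ℝ) := by
    have : {y : Space n | R < ‖y‖} ∈ 𝓝 x := (isOpen_lt continuous_const continuous_norm).mem_nhds hx
    filter_upwards [this] with y hy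
    simp [initial_u_eq_zero hs hy]
  have h2 := (hasFDerivAt_const (𝕜 := ℝ) (0 : ℝ) x).congr_of_eventuallyEq h1
  have h3 := (h2.hasLineDerivAt (basisVec i)).lineDeriv
  rw [(j.initial_g i x).lineDeriv] at h3
  simpa using h3

/-- The weighted energy in a backward light cone. -/
noncomputable def coneEnergyDensity (α ρ δ : ℝ) (x₀ : Space n) (v : ℝ → Space n → ℝ)
    (g : Fin n → ℝ → Space n → ℝ) (t : ℝ) (x : Space n) : ℝ :=
  coneDepth α ρ δ x₀ t x ^ 2 * (v t x ^ 2 + t ^ (-(2 * α)) * ∑ i, g i t x ^ 2)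

/-- Differential inequality for the weighted energy. -/
lemma SolutionJet.coneEnergy_deriv_le (j : SolutionJet α μ p u₀ u₁ ε T u ut utt g gt gx)
    (hα₀ : 0 ≤ α) (hα : α < 1) (hμ : 0 ≤ μ) (hp : 1 < p) {ρ δ M : ℝ} (hδ : 0 < δ) (x₀ : Space n)
    {t : ℝ} (h1 : 1 < t) (h2 : (t : EReal) < T)
    (hM : ∀ x ∈ Metric.closedBall x₀ ρ, |ut t x| ^ (p - 1) ≤ M) :
    ∃ E', HasDerivAt (fun t => ∫ x, coneEnergyDensity α ρ δ x₀ ut g t x) E' t ∧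
      E' ≤ 2 * M * ∫ x, coneEnergyDensity α ρ δ x₀ ut g t x := by
  set m := coneDepth α ρ δ x₀ with hm
  have hK : IsCompact (Metric.closedBall x₀ ρ) := isCompact_closedBall x₀ ρ
  have cm : ContinuousOn (fun z : ℝ × Space n => m z.1 z.2) (slab n T) := continuousOn_coneDepth
  have cv : ContinuousOn (fun z : ℝ × Space n => ut z.1 z.2) (slab n T) := j.cont_ut
  have ca : ContinuousOn (fun z : ℝ × Space n => utt z.1 z.2) (slab n T) := j.cont_utt
  have cg : ∀ i, ContinuousOn (fun z : ℝ × Space n => g i z.1 z.2) (slab n T) := j.cont_g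
  have cgt : ∀ i, ContinuousOn (fun z : ℝ × Space n => gt i z.1 z.2) (slab n T) := j.cont_gt
  have cgx : ∀ i, ContinuousOn (fun z : ℝ × Space n => gx i z.1 z.2) (slab n T) := j.cont_gx
  have cr : ∀ a : ℝ, ContinuousOn (fun z : ℝ × Space n => z.1 ^ a) (slab n T) := fun a =>
    continuousOn_slab_fst (continuousOn_rpow_Ici a)
  have hm0 : ∀ r ∈ timeInterval T, ∀ x ∉ Metric.closedBall x₀ ρ, m r x = 0 := by
    intro r hr x hx
    apply coneDepth_eq_zero
    have : ρ < ‖x - x₀‖ := by simpa [dist_eq_norm] using hx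
    linarith [lightDist_nonneg hα hr.1]
  have cslice : ∀ {f : ℝ → Space n → ℝ}, ContinuousOn (fun z : ℝ × Space n => f z.1 z.2) (slab n T)
      → Continuous (f t) := fun hf => continuous_slice hf (⟨h1.le, h2⟩ : t ∈ timeInterval T)
  -- time derivative of the density
  set D : ℝ → Space n → ℝ := fun t x =>
    2 * m t x * (-t ^ (-α)) * (ut t x ^ 2 + t ^ (-(2 * α)) * ∑ i, g i t x ^ 2)
    + m t x ^ 2 * (2 * ut t x * utt t x + (-(2 * α) * t ^ (-(2 * α) - 1) * ∑ i, g i t x ^ 2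
      + t ^ (-(2 * α)) * ∑ i, 2 * g i t x * gt i t x)) with hD
  -- divergence terms
  set B : Fin n → Space n → ℝ := fun i x =>
    (2 * m t x * (-((x i - x₀ i) / smoothDist x₀ δ x))) * (ut t x * g i t x)
    + m t x ^ 2 * (gt i t x * g i t x + ut t x * gx i t x) with hB
  have cD : ContinuousOn (fun z : ℝ × Space n => D z.1 z.2) (slab n T) := by
    have := cr (-α); have := cr (-(2 * α)); have := cr (-(2 * α) - 1)
    simp only [hD]
    fun_prop
  have cN : Continuous (smoothDist x₀ δ) := continuous_smoothDist
  have cB : ∀ i, Continuous (B i) := fun i => by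
    have := cslice cm; have := cslice cv; have := cslice (cg i)
    have := cslice (cgt i); have := cslice (cgx i)
    have hne : ∀ x, smoothDist x₀ δ x ≠ 0 := fun x => (smoothDist_pos hδ x).ne'
    simp only [hB]
    fun_prop (disch := assumption)
  have cE : ContinuousOn (fun z : ℝ × Space n => coneEnergyDensity α ρ δ x₀ ut g z.1 z.2)
      (slab n T) := by
    have := cr (-(2 * α))
    simp only [coneEnergyDensity]
    rw [← hm]
    fun_prop
  have hts : t ∈ timeInterval T := ⟨h1.le, h2⟩
  have hB0 : ∀ i, ∀ x ∉ Metric.closedBall x₀ ρ, B i x = 0 := fun i x hx => by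
    simp [hB, hm0 t hts x hx]
  have hD0 : ∀ r ∈ timeInterval T, ∀ x ∉ Metric.closedBall x₀ ρ, D r x = 0 := fun r hr x hx => by
    simp [hD, hm0 r hr x hx]
  have hE0 : ∀ r ∈ timeInterval T, ∀ x ∉ Metric.closedBall x₀ ρ,
      coneEnergyDensity α ρ δ x₀ ut g r x = 0 := fun r hr x hx => by
    simp only [coneEnergyDensity]; rw [← hm, hm0 r hr x hx]; simp
  have hderiv : HasDerivAt (fun t => ∫ x, coneEnergyDensity α ρ δ x₀ ut g t x)
      (∫ x, D t x) t := by
    have hopen : IsOpen {s : ℝ | (s : EReal) < T} := isOpen_Iio.preimage continuous_coe_real_ereal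
    set s : Set ℝ := Ioi 1 ∩ {s : ℝ | (s : EReal) < T} with hs
    have hsub : s ⊆ timeInterval T := fun r hr => ⟨le_of_lt hr.1, hr.2⟩
    refine hasDerivAt_integral_of_compact_support (s := s)
      (inter_mem (Ioi_mem_nhds h1) (hopen.mem_nhds h2)) hK
      (cE.mono (prod_mono_left hsub)) (cD.mono (prod_mono_left hsub))
      (fun r hr => hE0 r (hsub hr)) (fun r hr => hD0 r (hsub hr)) ?_
    intro r hr x
    have hr0 : 0 < r := lt_trans one_pos hr.1
    have d1 : HasDerivAt (fun t => m t x ^ 2) (2 * m r x * (-r ^ (-α))) r :=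
      hasDerivAt_coneDepth_sq hα hr0 x
    have d2 := (j.deriv_ut r hr.1 hr.2 x).pow 2
    have d3 : HasDerivAt (fun t : ℝ => t ^ (-(2 * α))) (-(2 * α) * r ^ (-(2 * α) - 1)) r :=
      Real.hasDerivAt_rpow_const (Or.inl hr0.ne')
    have d4 : HasDerivAt (fun t => ∑ i, g i t x ^ 2) (∑ i, 2 * g i r x * gt i r x) r := by
      refine HasDerivAt.fun_sum fun i _ => ?_
      simpa using (j.deriv_g i r hr.1 hr.2 x).fun_pow 2
    have d5 := d1.mul (d2.add (d3.mul d4))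
    refine (d5.congr_deriv ?_)
    simp [hD]
  refine ⟨_, hderiv, ?_⟩
  -- `B i` is the `i`-th partial derivative of `m² u_t ∂ᵢu`. Subtracting `2 t^(-2α) ∑ B i` thus
  -- leaves the integral of `D` unchanged and cancels the terms with second spatial or mixed
  -- derivatives.
  have hBint : ∀ i, ∫ x, B i x = 0 := fun i => by
    refine integral_lineDeriv_eq_zero (v := basisVec i) hK
      (f := fun x => m t x ^ 2 * (ut t x * g i t x)) ?_ (cB i) ?_ (hB0 i) fun x => ?_
    · have := cslice cm; have := cslice cv; have := cslice (cg i)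
      fun_prop
    · intro x hx; simp [hm0 t hts x hx]
    · exact hasLineDerivAt_mul (hasLineDerivAt_coneDepth_sq hδ t x i)
        (hasLineDerivAt_mul (j.lineDeriv_ut i t h1 h2 x) (j.lineDeriv_g i t h1 h2 x))
  have iD : Integrable (D t) :=
    integrable_of_continuous_of_zero_off hK (cslice cD) (hD0 t hts)
  have iB : ∀ i, Integrable (B i) := fun i =>
    integrable_of_continuous_of_zero_off hK (cB i) (hB0 i)
  have iE : Integrable (coneEnergyDensity α ρ δ x₀ ut g t) :=
    integrable_of_continuous_of_zero_off hK (cslice cE) (hE0 t hts)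
  have hsplit : ∫ x, D t x = ∫ x, (D t x - 2 * t ^ (-(2 * α)) * ∑ i, B i x) := by
    rw [integral_sub iD ((integrable_finsetSum _ fun i _ => iB i).const_mul _),
      integral_const_mul, integral_finsetSum _ fun i _ => iB i]
    simp [hBint]
  rw [hsplit, ← integral_const_mul]
  refine integral_mono (iD.sub ((integrable_finsetSum _ fun i _ => iB i).const_mul _))
    (iE.const_mul _) fun x => ?_
  have ht0 : 0 < t := by linarith
  set y : Fin n → ℝ := fun i => (x i - x₀ i) / smoothDist x₀ δ x with hy
  have hflux := flux_nonneg (ut t x) (t ^ (-α)) (fun i => g i t x) y (sum_sq_smoothDist_le hδ x)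
  have hpw : t ^ (-(2 * α)) = (t ^ (-α)) ^ 2 := by
    rw [← Real.rpow_natCast, ← Real.rpow_mul ht0.le]; congr 1; push_cast; ring
  have hsa : 0 < t ^ (-α) := by positivity
  have hm0' : 0 ≤ m t x := coneDepth_nonneg t x
  have heq := j.equation t h1 h2 x
  have hpw2 : 1 / t ^ (2 * α) = (t ^ (-α)) ^ 2 := by
    rw [← hpw, Real.rpow_neg ht0.le, one_div]
  have hsumB : ∑ i, B i x = - (2 * m t x * ut t x * ∑ i, y i * g i t x)
      + m t x ^ 2 * (∑ i, g i t x * gt i t x + ut t x * ∑ i, gx i t x) := by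
    simp only [hB, Finset.mul_sum, ← Finset.sum_add_distrib, ← Finset.sum_neg_distrib]
    exact Finset.sum_congr rfl fun i _ => by simp only [hy]; ring
  have hsum2 : ∑ i, 2 * g i t x * gt i t x = 2 * ∑ i, g i t x * gt i t x := by
    rw [Finset.mul_sum]; exact Finset.sum_congr rfl fun i _ => by ring
  -- After the equation is inserted, the flux forms a nonnegative expression with a negative factor,
  -- and the damping and the derivative of `t^(-2α)` contribute nonpositive terms. Only the source
  -- can increase the energy.
  have hid : D t x - 2 * t ^ (-(2 * α)) * ∑ i, B i x
      = -(2 * m t x * t ^ (-α)) * (ut t x ^ 2 + (t ^ (-α)) ^ 2 * ∑ i, g i t x ^ 2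
          - 2 * (t ^ (-α) * ut t x * ∑ i, y i * g i t x))
        + m t x ^ 2 * (2 * (ut t x * |ut t x| ^ p) - 2 * (μ / t) * ut t x ^ 2
          - 2 * α * t ^ (-(2 * α) - 1) * ∑ i, g i t x ^ 2) := by
    rw [hsumB]
    simp only [hD]
    rw [heq, hpw2, hsum2, hpw]
    ring
  have hG : 0 ≤ ∑ i, g i t x ^ 2 := Finset.sum_nonneg fun i _ => sq_nonneg _
  show D t x - 2 * t ^ (-(2 * α)) * ∑ i, B i x ≤ 2 * M * coneEnergyDensity α ρ δ x₀ ut g t x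
  rw [hid]
  by_cases hx : x ∈ Metric.closedBall x₀ ρ
  · have hMx := hM x hx
    have hM0 : 0 ≤ M := le_trans (by positivity) hMx
    have hnl : ut t x * |ut t x| ^ p ≤ M * ut t x ^ 2 := by
      have e : |ut t x| ^ p = |ut t x| ^ (p - 1) * |ut t x| := by
        rcases eq_or_ne (ut t x) 0 with h | h
        · simp [h, Real.zero_rpow (by linarith : p ≠ 0)]
        · rw [← Real.rpow_add_one (abs_ne_zero.2 h)]; ring_nf
      calc ut t x * |ut t x| ^ p ≤ |ut t x| * |ut t x| ^ p := by
            gcongr; exact le_abs_self _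
        _ = |ut t x| ^ (p - 1) * ut t x ^ 2 := by rw [e, ← sq_abs (ut t x)]; ring
        _ ≤ M * ut t x ^ 2 := by gcongr
    have hfl : 0 ≤ (2 * m t x * t ^ (-α)) * (ut t x ^ 2 + (t ^ (-α)) ^ 2 * ∑ i, g i t x ^ 2
          - 2 * (t ^ (-α) * ut t x * ∑ i, y i * g i t x)) := by positivity
    have h3 : 0 ≤ 2 * (μ / t) * ut t x ^ 2 := by positivity
    have h4 : 0 ≤ 2 * α * t ^ (-(2 * α) - 1) * ∑ i, g i t x ^ 2 := by positivity
    have h5 : 0 ≤ 2 * M * (t ^ (-(2 * α)) * ∑ i, g i t x ^ 2) := by positivity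
    have h6 : 0 ≤ m t x ^ 2 := sq_nonneg _
    simp only [coneEnergyDensity]
    rw [← hm]
    nlinarith
  · have := hm0 t hts x hx
    simp only [coneEnergyDensity]
    rw [← hm, this]
    simp

/-- Finite speed of propagation for the time derivative. -/
lemma SolutionJet.ut_eq_zero_of_lt (j : SolutionJet α μ p u₀ u₁ ε T u ut utt g gt gx)
    (hα₀ : 0 ≤ α) (hα : α < 1) (hμ : 0 ≤ μ) (hp : 1 < p)
    (hs₀ : tsupport u₀ ⊆ Metric.closedBall 0 R) (hs₁ : tsupport u₁ ⊆ Metric.closedBall 0 R)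
    {t : ℝ} (h1 : 1 ≤ t) (h2 : (t : EReal) < T) {x₀ : Space n} (hx : R + lightDist α t < ‖x₀‖) :
    ut t x₀ = 0 := by
  -- `ρ > A(t)` keeps `x₀` inside the cone at time `t`; `ρ < ‖x₀‖ - R` makes the base of the cone at
  -- time `1` miss the support of the data. The choice of `δ` then keeps the regularised depth at
  -- `x₀` positive.
  obtain ⟨ρ, hρ1, hρ2⟩ : ∃ ρ, lightDist α t < ρ ∧ ρ < ‖x₀‖ - R := exists_between (by linarith)
  obtain ⟨δ, hδ, hδ2⟩ : ∃ δ, 0 < δ ∧ δ < ρ - lightDist α t := exists_between (by linarith)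
  have hsub : Icc 1 t ⊆ timeInterval T := fun r hr =>
    ⟨hr.1, lt_of_le_of_lt (by exact_mod_cast hr.2) h2⟩
  have hK : IsCompact (Metric.closedBall x₀ ρ) := isCompact_closedBall x₀ ρ
  have cv : ContinuousOn (fun z : ℝ × Space n => ut z.1 z.2) (slab n T) := j.cont_ut
  have cg : ∀ i, ContinuousOn (fun z : ℝ × Space n => g i z.1 z.2) (slab n T) := j.cont_g
  have cm : ContinuousOn (fun z : ℝ × Space n => coneDepth α ρ δ x₀ z.1 z.2) (slab n T) :=
    continuousOn_coneDepth
  obtain ⟨M, hM⟩ : ∃ M, ∀ z ∈ Icc 1 t ×ˢ Metric.closedBall x₀ ρ, |ut z.1 z.2| ^ (p - 1) ≤ M := by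
    have hc : IsCompact (Icc 1 t ×ˢ Metric.closedBall x₀ ρ) := isCompact_Icc.prod hK
    have : ContinuousOn (fun z : ℝ × Space n => |ut z.1 z.2| ^ (p - 1))
        (Icc 1 t ×ˢ Metric.closedBall x₀ ρ) :=
      ((cv.mono (prod_mono hsub (subset_univ _))).abs).rpow_const fun _ _ => Or.inr (by linarith)
    obtain ⟨M, hM⟩ := hc.exists_bound_of_continuousOn this
    exact ⟨M, fun z hz => (le_abs_self _).trans (hM z hz)⟩
  set e : ℝ → ℝ := fun t => ∫ x, coneEnergyDensity α ρ δ x₀ ut g t x with he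
  have cE : ContinuousOn (fun z : ℝ × Space n => coneEnergyDensity α ρ δ x₀ ut g z.1 z.2)
      (slab n T) := by
    have : ContinuousOn (fun z : ℝ × Space n => z.1 ^ (-(2 * α))) (slab n T) :=
      continuousOn_slab_fst (continuousOn_rpow_Ici _)
    simp only [coneEnergyDensity]
    fun_prop
  have hE0 : ∀ r ∈ timeInterval T, ∀ x ∉ Metric.closedBall x₀ ρ,
      coneEnergyDensity α ρ δ x₀ ut g r x = 0 := fun r hr x hx => by
    have : ρ < ‖x - x₀‖ := by simpa [dist_eq_norm] using hx
    simp [coneEnergyDensity, coneDepth_eq_zero (α := α) (δ := δ) (t := r) (x := x) (x₀ := x₀)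
      (ρ := ρ) (by linarith [lightDist_nonneg hα hr.1])]
  have hEpos : ∀ r ∈ Icc 1 t, ∀ x, 0 ≤ coneEnergyDensity α ρ δ x₀ ut g r x := fun r hr x => by
    have : 0 < r := by linarith [hr.1]
    have hG : 0 ≤ ∑ i, g i r x ^ 2 := Finset.sum_nonneg fun i _ => sq_nonneg _
    unfold coneEnergyDensity
    positivity
  have ce : ContinuousOn e (Icc 1 t) :=
    (continuousOn_integral_of_compact_support hK cE
      (fun r x hr hx => hE0 r hr x hx)).mono hsub
  have he1 : e 1 = 0 := by
    have : ∀ x, coneEnergyDensity α ρ δ x₀ ut g 1 x = 0 := fun x => by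
      rcases le_or_gt ‖x‖ R with hxR | hxR
      · have : ‖x₀‖ - ‖x‖ ≤ ‖x - x₀‖ := by
          rw [norm_sub_rev]; exact norm_sub_norm_le _ _
        simp [coneEnergyDensity, coneDepth_eq_zero (α := α) (δ := δ) (t := 1) (x := x) (x₀ := x₀)
          (ρ := ρ) (by rw [lightDist_one]; linarith)]
      · simp [coneEnergyDensity, j.initial_g_eq_zero hs₀ hxR, j.initial_ut,
          initial_u_eq_zero hs₁ hxR]
    simp [he, this]
  -- Grönwall's argument. The size of `M`, which depends on the solution, is irrelevant because the
  -- initial energy is zero.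
  have hanti : AntitoneOn (fun r => e r * Real.exp (-(2 * M) * r)) (Icc 1 t) := by
    have key : ∀ r ∈ interior (Icc 1 t), ∃ E', HasDerivAt e E' r ∧ E' ≤ 2 * M * e r := by
      intro r hr
      rw [interior_Icc] at hr
      exact j.coneEnergy_deriv_le hα₀ hα hμ hp hδ x₀ hr.1 (hsub ⟨hr.1.le, hr.2.le⟩).2
        (fun x hx => hM (r, x) ⟨⟨hr.1.le, hr.2.le⟩, hx⟩)
    have hexp : ∀ r : ℝ, HasDerivAt (fun r : ℝ => Real.exp (-(2 * M) * r))
        (Real.exp (-(2 * M) * r) * (-(2 * M))) r := fun r => by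
      simpa using ((hasDerivAt_id r).const_mul (-(2 * M))).exp
    refine antitoneOn_of_deriv_nonpos (convex_Icc 1 t) (ce.mul (by fun_prop)) ?_ ?_
    · intro r hr
      obtain ⟨E', hE', _⟩ := key r hr
      exact (hE'.mul (hexp r)).differentiableAt.differentiableWithinAt
    · intro r hr
      obtain ⟨E', hE', hle⟩ := key r hr
      have hd := (hE'.mul (hexp r)).deriv
      have := Real.exp_pos (-(2 * M) * r)
      have hd' : deriv (fun r => e r * Real.exp (-(2 * M) * r)) r
          = (E' - 2 * M * e r) * Real.exp (-(2 * M) * r) := by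
        refine Eq.trans hd ?_; ring
      rw [hd']
      exact mul_nonpos_of_nonpos_of_nonneg (by linarith) this.le
  have het : e t = 0 := by
    have h3 := hanti (left_mem_Icc.2 h1) (right_mem_Icc.2 h1) h1
    simp only [he1, zero_mul] at h3
    have h4 : 0 ≤ e t := integral_nonneg (hEpos t (right_mem_Icc.2 h1))
    have := Real.exp_pos (-(2 * M) * t)
    nlinarith
  have hz := eq_zero_of_integral_eq_zero hK
    (continuous_slice cE (hsub (right_mem_Icc.2 h1))) (hE0 t (hsub (right_mem_Icc.2 h1)))
    (hEpos t (right_mem_Icc.2 h1)) het x₀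
  have hpos := coneDepth_pos_self (α := α) (x₀ := x₀) hδ (t := t) (ρ := ρ) (by linarith)
  have ht0 : 0 < t := by linarith
  have hG : 0 ≤ ∑ i, g i t x₀ ^ 2 := Finset.sum_nonneg fun i _ => sq_nonneg _
  have hG' : 0 ≤ t ^ (-(2 * α)) * ∑ i, g i t x₀ ^ 2 := by positivity
  unfold coneEnergyDensity at hz
  have h5 := (mul_eq_zero.1 hz).resolve_left (by positivity)
  have h6 : ut t x₀ ^ 2 = 0 := le_antisymm (by linarith) (sq_nonneg _)
  exact pow_eq_zero_iff (two_ne_zero) |>.1 h6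

/-- Finite speed of propagation. -/
lemma SolutionJet.u_eq_zero_of_lt (j : SolutionJet α μ p u₀ u₁ ε T u ut utt g gt gx)
    (hα₀ : 0 ≤ α) (hα : α < 1) (hμ : 0 ≤ μ) (hp : 1 < p)
    (hs₀ : tsupport u₀ ⊆ Metric.closedBall 0 R) (hs₁ : tsupport u₁ ⊆ Metric.closedBall 0 R)
    {t : ℝ} (h1 : 1 ≤ t) (h2 : (t : EReal) < T) {x₀ : Space n} (hx : R + lightDist α t < ‖x₀‖) :
    u t x₀ = 0 := by
  have hsub : Icc 1 t ⊆ timeInterval T := fun r hr =>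
    ⟨hr.1, lt_of_le_of_lt (by exact_mod_cast hr.2) h2⟩
  have hc : ContinuousOn (fun r => u r x₀) (Icc 1 t) :=
    j.cont_u.comp (f := fun r : ℝ => (r, x₀)) (by fun_prop) fun r hr => ⟨hsub hr, mem_univ _⟩
  have hR : R < ‖x₀‖ := by linarith [lightDist_nonneg hα h1]
  rcases h1.eq_or_lt with rfl | h1'
  · simp [j.initial_u, initial_u_eq_zero hs₀ hR]
  -- By the mean value theorem, the change of `u` at `x₀` is a multiple of `ut c x₀` with `c < t`;
  -- the propagation radius grows in time, so `x₀` is outside it at time `c` too.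
  obtain ⟨c, hc1, hc2⟩ := exists_hasDerivAt_eq_slope (fun r => u r x₀) (fun r => ut r x₀) h1' hc
    fun r hr => j.deriv_u r hr.1 (hsub ⟨hr.1.le, hr.2.le⟩).2 x₀
  have h3 : ut c x₀ = 0 := by
    refine j.ut_eq_zero_of_lt hα₀ hα hμ hp hs₀ hs₁ hc1.1.le (hsub ⟨hc1.1.le, hc1.2.le⟩).2 ?_
    have := lightDist_mono hα (by linarith [hc1.1] : 0 ≤ c) hc1.2.le
    linarith
  rw [h3, j.initial_u, initial_u_eq_zero hs₀ hR] at hc2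
  have h4 := (div_eq_zero_iff.1 hc2.symm).resolve_right (by linarith)
  simpa using h4

end FiniteSpeed

/-! ### Hölder's inequality, exponential weights and the moment equation -/

/-- The graph of the convex function `y ^ p` lies above its tangent at `m`; this is Bernoulli's
inequality at `y / m - 1`. -/
lemma rpow_tangent_le {p m y : ℝ} (hp : 1 ≤ p) (hm : 0 < m) (hy : 0 ≤ y) :
    m ^ p * (1 - p) + p * m ^ (p - 1) * y ≤ y ^ p := by
  have h := one_add_mul_self_le_rpow_one_add (s := y / m - 1) (p := p)
    (by have : 0 ≤ y / m := by positivity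
        linarith) hp
  have e : (1 + (y / m - 1)) ^ p = y ^ p / m ^ p := by
    rw [← Real.div_rpow hy hm.le]; congr 1; ring
  rw [e, le_div_iff₀ (by positivity)] at h
  have e2 : m ^ (p - 1) = m ^ p / m := by rw [Real.rpow_sub_one hm.ne']
  rw [e2]
  refine le_trans (le_of_eq ?_) h
  field_simp
  ring

/-- Hölder's inequality for a weighted integral over a compact set. -/
lemma abs_integral_mul_rpow_le {E : Type*} [TopologicalSpace E] [T2Space E]
    [MeasurableSpace E] [BorelSpace E] {ν : Measure E}
    [IsFiniteMeasureOnCompacts ν] {v φ : E → ℝ} {k : Set E} {p : ℝ} (hp : 1 < p)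
    (hk : IsCompact k) (hv : Continuous v) (hφ : Continuous φ) (h0 : ∀ x ∉ k, v x = 0)
    (hφ0 : ∀ x, 0 ≤ φ x) (hpos : 0 < ∫ x in k, φ x ∂ν) :
    |∫ x, v x * φ x ∂ν| ^ p ≤ (∫ x, |v x| ^ p * φ x ∂ν) * (∫ x in k, φ x ∂ν) ^ (p - 1) := by
  set Φ := ∫ x in k, φ x ∂ν with hΦ
  set V := |∫ x, v x * φ x ∂ν| with hV
  have hN : 0 ≤ ∫ x, |v x| ^ p * φ x ∂ν := integral_nonneg fun x => by
    have := hφ0 x; positivity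
  have hV0 : 0 ≤ V := abs_nonneg _
  rcases hV0.eq_or_lt with h | hVpos
  · rw [← h, Real.zero_rpow (by linarith)]; positivity
  -- Jensen's argument: integrating the tangent inequality at the weighted mean `m` against `φ`
  -- gives `m ^ p * Φ ≤ ∫ |v|^p φ`, which is Hölder's inequality rescaled.
  set m := V / Φ with hm
  have hmpos : 0 < m := by positivity
  have hcv : Continuous fun x => |v x| ^ p := hv.abs.rpow_const fun _ => Or.inr (by linarith)
  have e1 : ∫ x, |v x| * φ x ∂ν = ∫ x in k, |v x| * φ x ∂ν :=
    (setIntegral_eq_integral_of_forall_compl_eq_zero fun x hx => by simp [h0 x hx]).symm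
  have e2 : ∫ x, |v x| ^ p * φ x ∂ν = ∫ x in k, |v x| ^ p * φ x ∂ν :=
    (setIntegral_eq_integral_of_forall_compl_eq_zero fun x hx => by
      simp [h0 x hx, Real.zero_rpow (by linarith : p ≠ 0)]).symm
  have i1 : IntegrableOn (fun x => |v x| * φ x) k ν :=
    (hv.abs.mul hφ).continuousOn.integrableOn_compact hk
  have i2 : IntegrableOn (fun x => |v x| ^ p * φ x) k ν :=
    (hcv.mul hφ).continuousOn.integrableOn_compact hk
  have i3 : IntegrableOn φ k ν := hφ.continuousOn.integrableOn_compact hk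
  have h1 : V ≤ ∫ x in k, |v x| * φ x ∂ν := by
    rw [← e1, hV]
    refine (abs_integral_le_integral_abs).trans (le_of_eq ?_)
    refine integral_congr_ae (Eventually.of_forall fun x => ?_)
    simp [abs_mul, abs_of_nonneg (hφ0 x)]
  have h2 : m ^ p * (1 - p) * Φ + p * m ^ (p - 1) * ∫ x in k, |v x| * φ x ∂ν
      ≤ ∫ x in k, |v x| ^ p * φ x ∂ν := by
    rw [hΦ, ← integral_const_mul, ← integral_const_mul,
      ← integral_add (i3.const_mul _) (i1.const_mul _)]
    refine setIntegral_mono ((i3.const_mul _).add (i1.const_mul _)) i2 fun x => ?_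
    have := mul_le_mul_of_nonneg_right (rpow_tangent_le hp.le hmpos (abs_nonneg (v x))) (hφ0 x)
    dsimp only
    linarith
  have h3 : m ^ p * Φ ≤ ∫ x in k, |v x| ^ p * φ x ∂ν := by
    have h4 : p * m ^ (p - 1) * V ≤ p * m ^ (p - 1) * ∫ x in k, |v x| * φ x ∂ν := by gcongr
    have h5 : p * m ^ (p - 1) * V = p * m ^ p * Φ := by
      have : V = m * Φ := by rw [hm]; field_simp
      rw [this, Real.rpow_sub_one hmpos.ne']; field_simp
    nlinarith
  rw [e2]
  calc V ^ p = m ^ p * Φ * Φ ^ (p - 1) := by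
        rw [hm, Real.div_rpow hVpos.le hpos.le, Real.rpow_sub_one hpos.ne']
        field_simp
    _ ≤ _ := by gcongr

/-- The weight `exp (κ xᵢ)`, an eigenfunction of the Laplacian. -/
noncomputable def expWeight {n : ℕ} (κ : ℝ) (i : Fin n) (x : Space n) : ℝ := Real.exp (κ * x i)

section ExpWeight
variable {n : ℕ} {κ : ℝ} {i : Fin n}

lemma expWeight_pos (x : Space n) : 0 < expWeight κ i x := Real.exp_pos _

lemma continuous_expWeight : Continuous (expWeight κ i) := by
  unfold expWeight; fun_prop

lemma hasLineDerivAt_expWeight (x : Space n) (l : Fin n) :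
    HasLineDerivAt ℝ (expWeight κ i) ((if i = l then κ else 0) * expWeight κ i x) x
      (basisVec l) := by
  have h : HasDerivAt (fun s : ℝ => Real.exp (κ * (x i + s * if i = l then 1 else 0)))
      (Real.exp (κ * (x i + 0 * if i = l then 1 else 0)) * (κ * (1 * if i = l then 1 else 0))) 0 :=
    ((((hasDerivAt_id (0 : ℝ)).mul_const _).const_add (x i)).const_mul κ).exp
  have e : (fun s : ℝ => expWeight κ i (x + s • basisVec l))
      = fun s => Real.exp (κ * (x i + s * if i = l then 1 else 0)) := by
    ext s; simp [expWeight]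
  unfold HasLineDerivAt
  rw [e]
  refine h.congr_deriv ?_
  simp [expWeight]
  split_ifs <;> ring

end ExpWeight

lemma hasLineDerivAt_unique_zero {E : Type*} [NormedAddCommGroup E] [NormedSpace ℝ E] {f : E → ℝ}
    {f' : ℝ} {x v : E} (h : HasLineDerivAt ℝ f f' x v) (h0 : f =ᶠ[𝓝 x] fun _ => 0) : f' = 0 := by
  have h3 := (((hasFDerivAt_const (𝕜 := ℝ) (0 : ℝ) x).congr_of_eventuallyEq
    h0).hasLineDerivAt v).lineDeriv
  rw [h.lineDeriv] at h3
  simpa using h3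

section Moments

variable {n : ℕ} {α μ p R ε : ℝ} {u₀ u₁ : Space n → ℝ} {T : EReal}
  {u ut utt : ℝ → Space n → ℝ} {g gt gx : Fin n → ℝ → Space n → ℝ}

lemma SolutionJet.g_eq_zero_of_lt (j : SolutionJet α μ p u₀ u₁ ε T u ut utt g gt gx)
    (hα₀ : 0 ≤ α) (hα : α < 1) (hμ : 0 ≤ μ) (hp : 1 < p)
    (hs₀ : tsupport u₀ ⊆ Metric.closedBall 0 R) (hs₁ : tsupport u₁ ⊆ Metric.closedBall 0 R)
    {t : ℝ} (h1 : 1 < t) (h2 : (t : EReal) < T) {x : Space n} (hx : R + lightDist α t < ‖x‖)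
    (i : Fin n) : g i t x = 0 := by
  have ho : {y : Space n | R + lightDist α t < ‖y‖} ∈ 𝓝 x :=
    (isOpen_lt continuous_const continuous_norm).mem_nhds hx
  refine hasLineDerivAt_unique_zero (j.lineDeriv_u i t h1 h2 x) ?_
  filter_upwards [ho] with y hy
  exact j.u_eq_zero_of_lt hα₀ hα hμ hp hs₀ hs₁ h1.le h2 hy

lemma SolutionJet.gx_eq_zero_of_lt (j : SolutionJet α μ p u₀ u₁ ε T u ut utt g gt gx)
    (hα₀ : 0 ≤ α) (hα : α < 1) (hμ : 0 ≤ μ) (hp : 1 < p)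
    (hs₀ : tsupport u₀ ⊆ Metric.closedBall 0 R) (hs₁ : tsupport u₁ ⊆ Metric.closedBall 0 R)
    {t : ℝ} (h1 : 1 < t) (h2 : (t : EReal) < T) {x : Space n} (hx : R + lightDist α t < ‖x‖)
    (i : Fin n) : gx i t x = 0 := by
  have ho : {y : Space n | R + lightDist α t < ‖y‖} ∈ 𝓝 x :=
    (isOpen_lt continuous_const continuous_norm).mem_nhds hx
  refine hasLineDerivAt_unique_zero (j.lineDeriv_g i t h1 h2 x) ?_
  filter_upwards [ho] with y hy
  exact j.g_eq_zero_of_lt hα₀ hα hμ hp hs₀ hs₁ h1 h2 hy i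

/-- The weighted mean `∫ f(x) exp(κ xᵢ) dx`. -/
noncomputable def moment (κ : ℝ) (i : Fin n) (f : Space n → ℝ) : ℝ :=
  ∫ x, f x * expWeight κ i x

/-- The mass of the exponential weight on a ball. -/
noncomputable def ballMass (n : ℕ) (κ : ℝ) (i : Fin n) (r : ℝ) : ℝ :=
  ∫ x in Metric.closedBall (0 : Space n) r, expWeight κ i x

lemma ballMass_pos {κ : ℝ} {i : Fin n} {r : ℝ} (hr : 0 < r) : 0 < ballMass n κ i r := by
  unfold ballMass
  rw [setIntegral_pos_iff_support_of_nonneg_ae]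
  · have : support (expWeight κ i : Space n → ℝ) = univ := by
      ext x; simpa using (expWeight_pos x).ne'
    rw [this, univ_inter]
    exact Metric.measure_closedBall_pos _ _ hr
  · exact Eventually.of_forall fun x => (expWeight_pos x).le
  · exact continuous_expWeight.continuousOn.integrableOn_compact (isCompact_closedBall _ _)

/-- The exponential moments of a solution satisfy an ordinary differential equation, whose
source term is bounded below by Hölder's inequality. -/
theorem SolutionJet.moment_ode (j : SolutionJet α μ p u₀ u₁ ε T u ut utt g gt gx)
    (hα₀ : 0 ≤ α) (hα : α < 1) (hμ : 0 ≤ μ) (hp : 1 < p) (hR : 0 < R)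
    (hs₀ : tsupport u₀ ⊆ Metric.closedBall 0 R) (hs₁ : tsupport u₁ ⊆ Metric.closedBall 0 R)
    (κ : ℝ) (i : Fin n) :
    (∀ b : ℝ, (b : EReal) < T → ContinuousOn (fun t => moment κ i (u t)) (Icc 1 b)) ∧
    (∀ b : ℝ, (b : EReal) < T → ContinuousOn (fun t => moment κ i (ut t)) (Icc 1 b)) ∧
    (∀ b : ℝ, (b : EReal) < T →
      ContinuousOn (fun t => moment κ i (fun x => |ut t x| ^ p)) (Icc 1 b)) ∧
    (∀ t : ℝ, 1 < t → (t : EReal) < T →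
      HasDerivAt (fun t => moment κ i (u t)) (moment κ i (ut t)) t) ∧
    (∀ t : ℝ, 1 < t → (t : EReal) < T →
      HasDerivAt (fun t => moment κ i (ut t))
        (κ ^ 2 * t ^ (-(2 * α)) * moment κ i (u t) - μ / t * moment κ i (ut t)
          + moment κ i (fun x => |ut t x| ^ p)) t) ∧
    (∀ t : ℝ, 1 ≤ t → (t : EReal) < T →
      |moment κ i (ut t)| ^ p ≤ moment κ i (fun x => |ut t x| ^ p)
        * ballMass n κ i (R + lightDist α t) ^ (p - 1)) := by
  have hp0 : p ≠ 0 := by linarith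
  set φ : Space n → ℝ := expWeight κ i with hφ
  have cφ : Continuous φ := continuous_expWeight
  have cφ' : ∀ s : Set (ℝ × Space n), ContinuousOn (fun z : ℝ × Space n => φ z.2) s := fun s =>
    (cφ.comp continuous_snd).continuousOn
  have hsub : ∀ {b : ℝ}, (b : EReal) < T → Icc 1 b ⊆ timeInterval T := fun hb r hr =>
    ⟨hr.1, lt_of_le_of_lt (by exact_mod_cast hr.2) hb⟩
  have cu : ∀ {b : ℝ}, (b : EReal) < T →
      ContinuousOn (fun z : ℝ × Space n => u z.1 z.2) (Icc 1 b ×ˢ univ) := fun hb =>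
    j.cont_u.mono (prod_mono_left (hsub hb))
  have cv : ∀ {b : ℝ}, (b : EReal) < T →
      ContinuousOn (fun z : ℝ × Space n => ut z.1 z.2) (Icc 1 b ×ˢ univ) := fun hb =>
    j.cont_ut.mono (prod_mono_left (hsub hb))
  have ca : ∀ {b : ℝ}, (b : EReal) < T →
      ContinuousOn (fun z : ℝ × Space n => utt z.1 z.2) (Icc 1 b ×ˢ univ) := fun hb =>
    j.cont_utt.mono (prod_mono_left (hsub hb))
  have hK : ∀ r, IsCompact (Metric.closedBall (0 : Space n) r) := fun r => isCompact_closedBall _ _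
  have hout : ∀ {b r : ℝ} {x : Space n}, r ∈ Icc 1 b →
      x ∉ Metric.closedBall (0 : Space n) (R + lightDist α b) → R + lightDist α r < ‖x‖ := by
    intro b r x hr hx
    have h1 : R + lightDist α b < ‖x‖ := by simpa using hx
    linarith [lightDist_mono hα (by linarith [hr.1] : 0 ≤ r) hr.2]
  have hu0 : ∀ {b : ℝ}, (b : EReal) < T → ∀ r ∈ Icc 1 b,
      ∀ x ∉ Metric.closedBall (0 : Space n) (R + lightDist α b), u r x = 0 :=
    fun hb r hr x hx => j.u_eq_zero_of_lt hα₀ hα hμ hp hs₀ hs₁ hr.1 (hsub hb hr).2 (hout hr hx)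
  have hv0 : ∀ {b : ℝ}, (b : EReal) < T → ∀ r ∈ Icc 1 b,
      ∀ x ∉ Metric.closedBall (0 : Space n) (R + lightDist α b), ut r x = 0 :=
    fun hb r hr x hx => j.ut_eq_zero_of_lt hα₀ hα hμ hp hs₀ hs₁ hr.1 (hsub hb hr).2 (hout hr hx)
  have hg0 : ∀ {b : ℝ}, (b : EReal) < T → ∀ r ∈ Ioo 1 b,
      ∀ x ∉ Metric.closedBall (0 : Space n) (R + lightDist α b), ∀ l, g l r x = 0 :=
    fun hb r hr x hx l => j.g_eq_zero_of_lt hα₀ hα hμ hp hs₀ hs₁ hr.1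
      (hsub hb (Ioo_subset_Icc_self hr)).2 (hout (Ioo_subset_Icc_self hr) hx) l
  have hgx0 : ∀ {b : ℝ}, (b : EReal) < T → ∀ r ∈ Ioo 1 b,
      ∀ x ∉ Metric.closedBall (0 : Space n) (R + lightDist α b), ∀ l, gx l r x = 0 :=
    fun hb r hr x hx l => j.gx_eq_zero_of_lt hα₀ hα hμ hp hs₀ hs₁ hr.1
      (hsub hb (Ioo_subset_Icc_self hr)).2 (hout (Ioo_subset_Icc_self hr) hx) l
  have hbtw : ∀ {t : ℝ}, (t : EReal) < T → ∃ b : ℝ, t < b ∧ (b : EReal) < T := fun ht => by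
    obtain ⟨b, h1, h2⟩ := EReal.lt_iff_exists_real_btwn.1 ht
    exact ⟨b, by exact_mod_cast h1, h2⟩
  refine ⟨fun b hb => ?_, fun b hb => ?_, fun b hb => ?_, fun t h1 h2 => ?_, fun t h1 h2 => ?_,
    fun t h1 h2 => ?_⟩
  · exact continuousOn_integral_of_compact_support (hK (R + lightDist α b))
      ((cu hb).mul (cφ' _)) fun r x hr hx => by simp [hu0 hb r hr x hx]
  · exact continuousOn_integral_of_compact_support (hK (R + lightDist α b))
      ((cv hb).mul (cφ' _)) fun r x hr hx => by simp [hv0 hb r hr x hx]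
  · refine continuousOn_integral_of_compact_support (hK (R + lightDist α b))
      (((cv hb).abs.rpow_const fun _ _ => Or.inr (by linarith)).mul (cφ' _)) fun r x hr hx => ?_
    simp [hv0 hb r hr x hx, Real.zero_rpow hp0]
  · obtain ⟨b, htb, hb⟩ := hbtw h2
    refine hasDerivAt_integral_of_compact_support (s := Ioo 1 b) (F := fun r x => u r x * φ x)
      (F' := fun r x => ut r x * φ x) (Ioo_mem_nhds h1 htb) (hK (R + lightDist α b))
      (((cu hb).mono (prod_mono_left Ioo_subset_Icc_self)).mul (cφ' _))
      (((cv hb).mono (prod_mono_left Ioo_subset_Icc_self)).mul (cφ' _))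
      (fun r hr x hx => ?_) (fun r hr x hx => ?_) (fun r hr x => ?_)
    · simp [hu0 hb r (Ioo_subset_Icc_self hr) x hx]
    · simp [hv0 hb r (Ioo_subset_Icc_self hr) x hx]
    · exact (j.deriv_u r hr.1 (hsub hb (Ioo_subset_Icc_self hr)).2 x).mul_const _
  · obtain ⟨b, htb, hb⟩ := hbtw h2
    have ht : t ∈ Ioo 1 b := ⟨h1, htb⟩
    have hd : HasDerivAt (fun t => moment κ i (ut t)) (∫ x, utt t x * φ x) t := by
      refine hasDerivAt_integral_of_compact_support (s := Ioo 1 b) (F := fun r x => ut r x * φ x)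
        (F' := fun r x => utt r x * φ x) (Ioo_mem_nhds h1 htb) (hK (R + lightDist α b))
        (((cv hb).mono (prod_mono_left Ioo_subset_Icc_self)).mul (cφ' _))
        (((ca hb).mono (prod_mono_left Ioo_subset_Icc_self)).mul (cφ' _))
        (fun r hr x hx => ?_) (fun r hr x hx => ?_) (fun r hr x => ?_)
      · simp [hv0 hb r (Ioo_subset_Icc_self hr) x hx]
      -- The equation expresses `utt` through quantities already known to vanish there.
      · have : utt r x = 0 := by
          rw [j.equation r hr.1 (hsub hb (Ioo_subset_Icc_self hr)).2 x,
            hv0 hb r (Ioo_subset_Icc_self hr) x hx]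
          simp [hgx0 hb r hr x hx, Real.zero_rpow hp0]
        simp [this]
      · exact (j.deriv_ut r hr.1 (hsub hb (Ioo_subset_Icc_self hr)).2 x).mul_const _
    refine hd.congr_deriv ?_
    have hts : t ∈ timeInterval T := ⟨h1.le, h2⟩
    have cut : Continuous (ut t) := continuous_slice j.cont_ut hts
    have cus : Continuous (u t) := continuous_slice j.cont_u hts
    have cgs : ∀ l, Continuous (g l t) := fun l => continuous_slice (j.cont_g l) hts
    have cgxs : ∀ l, Continuous (gx l t) := fun l => continuous_slice (j.cont_gx l) hts
    have cN : Continuous fun x => |ut t x| ^ p :=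
      cut.abs.rpow_const fun _ => Or.inr (by linarith)
    have zu := hu0 hb t (Ioo_subset_Icc_self ht)
    have zv := hv0 hb t (Ioo_subset_Icc_self ht)
    have zg := hg0 hb t ht
    have zgx := hgx0 hb t ht
    have iu : Integrable fun x => u t x * φ x :=
      integrable_of_continuous_of_zero_off (hK (R + lightDist α b)) (cus.mul cφ) fun x hx => by simp [zu x hx]
    have iv : Integrable fun x => ut t x * φ x :=
      integrable_of_continuous_of_zero_off (hK (R + lightDist α b)) (cut.mul cφ) fun x hx => by simp [zv x hx]
    have iN : Integrable fun x => |ut t x| ^ p * φ x :=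
      integrable_of_continuous_of_zero_off (hK (R + lightDist α b)) (cN.mul cφ) fun x hx => by
        simp [zv x hx, Real.zero_rpow hp0]
    have ig : ∀ l, Integrable fun x => g l t x * φ x := fun l =>
      integrable_of_continuous_of_zero_off (hK (R + lightDist α b)) ((cgs l).mul cφ) fun x hx => by simp [zg x hx]
    have igx : ∀ l, Integrable fun x => gx l t x * φ x := fun l =>
      integrable_of_continuous_of_zero_off (hK (R + lightDist α b)) ((cgxs l).mul cφ) fun x hx => by simp [zgx x hx]
    -- Two integrations by parts move `∂ₗ²` onto the weight; each contributes a factor `-c`, and `c`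
    -- is nonzero only for `l = i`, where it equals `κ`.
    have hgint : ∀ l, ∫ x, gx l t x * φ x
        = (if i = l then κ else 0) ^ 2 * ∫ x, u t x * φ x := by
      intro l
      set c : ℝ := if i = l then κ else 0 with hc
      have A1 : ∫ x, (gx l t x * φ x + g l t x * (c * φ x)) = 0 := by
        refine integral_lineDeriv_eq_zero (v := basisVec l) (hK (R + lightDist α b))
          (f := fun x => g l t x * φ x) ((cgs l).mul cφ)
          (((cgxs l).mul cφ).add ((cgs l).mul (continuous_const.mul cφ))) (fun x hx => ?_)
          (fun x hx => ?_) fun x => ?_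
        · simp [zg x hx]
        · simp [zg x hx, zgx x hx]
        · exact hasLineDerivAt_mul (j.lineDeriv_g l t h1 h2 x) (hasLineDerivAt_expWeight x l)
      have A2 : ∫ x, (g l t x * φ x + u t x * (c * φ x)) = 0 := by
        refine integral_lineDeriv_eq_zero (v := basisVec l) (hK (R + lightDist α b))
          (f := fun x => u t x * φ x) (cus.mul cφ)
          (((cgs l).mul cφ).add (cus.mul (continuous_const.mul cφ))) (fun x hx => ?_)
          (fun x hx => ?_) fun x => ?_
        · simp [zu x hx]
        · simp [zu x hx, zg x hx]
        · exact hasLineDerivAt_mul (j.lineDeriv_u l t h1 h2 x) (hasLineDerivAt_expWeight x l)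
      have B1 : ∫ x, (gx l t x * φ x + g l t x * (c * φ x))
          = (∫ x, gx l t x * φ x) + c * ∫ x, g l t x * φ x := by
        rw [← integral_const_mul, ← integral_add (igx l) ((ig l).const_mul c)]
        exact integral_congr_ae (Eventually.of_forall fun x => by dsimp only; ring)
      have B2 : ∫ x, (g l t x * φ x + u t x * (c * φ x))
          = (∫ x, g l t x * φ x) + c * ∫ x, u t x * φ x := by
        rw [← integral_const_mul, ← integral_add (ig l) (iu.const_mul c)]
        exact integral_congr_ae (Eventually.of_forall fun x => by dsimp only; ring)
      rw [B1] at A1; rw [B2] at A2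
      linear_combination A1 - c * A2
    have ht0 : 0 < t := by linarith
    have e : ∀ x, utt t x * φ x = t ^ (-(2 * α)) * (∑ l, gx l t x * φ x)
        - μ / t * (ut t x * φ x) + |ut t x| ^ p * φ x := fun x => by
      rw [j.equation t h1 h2 x, Real.rpow_neg ht0.le, ← Finset.sum_mul]
      ring
    have is : Integrable fun x => ∑ l, gx l t x * φ x := integrable_finsetSum _ fun l _ => igx l
    have ib : Integrable fun x => t ^ (-(2 * α)) * (∑ l, gx l t x * φ x)
        - μ / t * (ut t x * φ x) := (is.const_mul _).sub (iv.const_mul _)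
    simp_rw [e]
    rw [integral_add ib iN,
      integral_sub (is.const_mul _) (iv.const_mul _), integral_const_mul, integral_const_mul,
      integral_finsetSum _ fun l _ => igx l]
    simp_rw [hgint, ← Finset.sum_mul]
    have hs : ∑ l, (if i = l then κ else 0) ^ 2 = κ ^ 2 := by simp [ite_pow]
    rw [hs]
    simp only [moment]
    ring
  · refine abs_integral_mul_rpow_le hp (hK _) (continuous_slice j.cont_ut ⟨h1, h2⟩) cφ
      (hv0 h2 t ⟨h1, le_rfl⟩) (fun x => (expWeight_pos x).le) (ballMass_pos ?_)
    linarith [lightDist_nonneg hα h1]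

end Moments

/-! ### Mass of the exponential weight on a ball -/

/-- The one-dimensional factors of an integrable majorant of the exponential weight on a ball. -/
noncomputable def majorantFactor {n : ℕ} (i : Fin n) (r : ℝ) (l : Fin n) (s : ℝ) : ℝ :=
  if l = i then (Iic r).indicator (fun s => Real.exp (1 / 2 * s)) s
  else Real.exp (-(1 / (4 * r)) * s ^ 2)

lemma majorantFactor_self {n : ℕ} (i : Fin n) (r : ℝ) :
    majorantFactor i r i = (Iic r).indicator fun s => Real.exp (1 / 2 * s) := by
  ext s; simp [majorantFactor]

lemma majorantFactor_of_ne {n : ℕ} {i l : Fin n} (h : l ≠ i) (r : ℝ) :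
    majorantFactor i r l = fun s => Real.exp (-(1 / (4 * r)) * s ^ 2) := by
  ext s; simp [majorantFactor, h]

lemma majorantFactor_nonneg {n : ℕ} (i : Fin n) (r : ℝ) (l : Fin n) (s : ℝ) :
    0 ≤ majorantFactor i r l s := by
  unfold majorantFactor
  split_ifs
  · exact indicator_nonneg (fun _ _ => (Real.exp_pos _).le) _
  · exact (Real.exp_pos _).le

lemma integrable_majorantFactor {n : ℕ} (i : Fin n) {r : ℝ} (hr : 0 < r) (l : Fin n) :
    Integrable (majorantFactor i r l) := by
  by_cases h : l = i
  · subst h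
    rw [majorantFactor_self, integrable_indicator_iff measurableSet_Iic]
    exact integrableOn_exp_mul_Iic (by norm_num) r
  · rw [majorantFactor_of_ne h]
    exact integrable_exp_neg_mul_sq (by positivity)

lemma integral_majorantFactor_self {n : ℕ} (i : Fin n) (r : ℝ) :
    ∫ s, majorantFactor i r i s = 2 * Real.exp (r / 2) := by
  rw [majorantFactor_self, integral_indicator measurableSet_Iic,
    integral_exp_mul_Iic (by norm_num)]
  rw [show 1 / 2 * r = r / 2 by ring]
  ring

lemma integral_majorantFactor_of_ne {n : ℕ} {i l : Fin n} (h : l ≠ i) (r : ℝ) :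
    ∫ s, majorantFactor i r l s = √(4 * Real.pi * r) := by
  rw [majorantFactor_of_ne h, integral_gaussian]
  rw [div_div_eq_mul_div, div_one]
  congr 1; ring

/-- With `x'` the coordinates other than `xᵢ`, the ball gives `|x'|² ≤ r² - xᵢ² ≤ 2r (r - xᵢ)`, that
is `xᵢ/2 ≤ r/2 - |x'|²/(4r)`. Half of the exponent is traded for a Gaussian in `x'`, the other half
keeps integrability in `xᵢ ≤ r`. The Gaussian has width of order `√r`, which yields `r^((n-1)/2)`,
the power behind `p_G'`. -/
lemma expWeight_le_majorant {n : ℕ} (i : Fin n) {r : ℝ} (hr : 0 < r) {x : Space n}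
    (hx : x ∈ Metric.closedBall (0 : Space n) r) :
    expWeight 1 i x ≤ Real.exp (r / 2) * ∏ l, majorantFactor i r l (x l) := by
  have hn : ‖x‖ ≤ r := by simpa using hx
  have hsq : ∑ l, x l ^ 2 ≤ r ^ 2 := by
    have h := EuclideanSpace.norm_sq_eq x
    simp only [Real.norm_eq_abs, sq_abs] at h
    rw [← h]; gcongr
  have hsplit : ∑ l, x l ^ 2 = x i ^ 2 + ∑ l ∈ Finset.univ.erase i, x l ^ 2 :=
    (Finset.add_sum_erase _ _ (Finset.mem_univ i)).symm
  have hnn : 0 ≤ ∑ l ∈ Finset.univ.erase i, x l ^ 2 := Finset.sum_nonneg fun _ _ => sq_nonneg _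
  have hxi : x i ≤ r := by
    apply le_of_sq_le_sq _ hr.le
    linarith
  have hprod : ∏ l, majorantFactor i r l (x l)
      = Real.exp (1 / 2 * x i - 1 / (4 * r) * ∑ l ∈ Finset.univ.erase i, x l ^ 2) := by
    rw [← Finset.mul_prod_erase _ _ (Finset.mem_univ i), sub_eq_add_neg, Real.exp_add,
      majorantFactor_self, indicator_of_mem (mem_Iic.2 hxi), ← neg_mul, Finset.mul_sum,
      Real.exp_sum]
    congr 1
    refine Finset.prod_congr rfl fun l hl => ?_
    rw [majorantFactor_of_ne (Finset.ne_of_mem_erase hl)]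
  rw [hprod, ← Real.exp_add, expWeight, Real.exp_le_exp]
  set q := ∑ l ∈ Finset.univ.erase i, x l ^ 2 with hq
  have : 1 / (4 * r) * q ≤ r / 2 - x i / 2 := by
    rw [one_div, inv_mul_le_iff₀ (by positivity)]
    nlinarith [sq_nonneg (r - x i)]
  linarith

lemma integrable_prod_majorantFactor {n : ℕ} (i : Fin n) {r : ℝ} (hr : 0 < r) :
    Integrable fun x : Space n => ∏ l, majorantFactor i r l (x l) := by
  rw [← (PiLp.volume_preserving_toLp (Fin n)).integrable_comp_emb
    (MeasurableEquiv.toLp 2 _).measurableEmbedding]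
  exact Integrable.fintype_prod (f := majorantFactor i r) (μ := fun _ => volume)
    fun l => integrable_majorantFactor i hr l

lemma integral_prod_majorantFactor {n : ℕ} (i : Fin n) (r : ℝ) :
    ∫ x : Space n, ∏ l, majorantFactor i r l (x l)
      = 2 * Real.exp (r / 2) * √(4 * Real.pi * r) ^ (n - 1) := by
  rw [← (PiLp.volume_preserving_toLp (Fin n)).integral_comp
    (MeasurableEquiv.toLp 2 _).measurableEmbedding]
  rw [integral_fintype_prod_volume_eq_prod (f := majorantFactor i r),
    ← Finset.mul_prod_erase _ _ (Finset.mem_univ i), integral_majorantFactor_self,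
    Finset.prod_congr rfl fun l hl =>
      integral_majorantFactor_of_ne (Finset.ne_of_mem_erase hl) r]
  simp

/-- The mass of `exp (xᵢ)` on the ball of radius `r` is `O(eʳ r^((n-1)/2))`. -/
lemma ballMass_one_le {n : ℕ} (i : Fin n) {r : ℝ} (hr : 0 < r) :
    ballMass n 1 i r ≤ 2 * Real.exp r * √(4 * Real.pi * r) ^ (n - 1) := by
  set Q : Space n → ℝ := fun x => ∏ l, majorantFactor i r l (x l) with hQ
  have hint : Integrable Q := integrable_prod_majorantFactor i hr
  have hval : ∫ x, Q x = 2 * Real.exp (r / 2) * √(4 * Real.pi * r) ^ (n - 1) :=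
    integral_prod_majorantFactor i r
  have hpos : ∀ x, 0 ≤ Q x := fun x => Finset.prod_nonneg fun l _ => majorantFactor_nonneg i r l _
  have hle : ∀ x ∈ Metric.closedBall (0 : Space n) r, expWeight 1 i x ≤ Real.exp (r / 2) * Q x :=
    fun x hx => expWeight_le_majorant i hr hx
  clear_value Q
  have hexp : IntegrableOn (expWeight 1 i) (Metric.closedBall (0 : Space n) r) :=
    continuous_expWeight.continuousOn.integrableOn_compact (isCompact_closedBall _ _)
  calc ballMass n 1 i r
      ≤ ∫ x in Metric.closedBall (0 : Space n) r, Real.exp (r / 2) * Q x :=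
        setIntegral_mono_on hexp (hint.const_mul _).integrableOn
          Metric.isClosed_closedBall.measurableSet hle
    _ ≤ ∫ x, Real.exp (r / 2) * Q x :=
        setIntegral_le_integral (hint.const_mul _)
          (Eventually.of_forall fun x => mul_nonneg (Real.exp_pos _).le (hpos x))
    _ = 2 * Real.exp r * √(4 * Real.pi * r) ^ (n - 1) := by
        rw [integral_const_mul, hval]
        have : Real.exp r = Real.exp (r / 2) * Real.exp (r / 2) := by
          rw [← Real.exp_add]; congr 1; ring
        rw [this]; ring

lemma ballMass_zero {n : ℕ} (i : Fin n) {r : ℝ} (hr : 0 ≤ r) :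
    ballMass n 0 i r = r ^ n * volume.real (Metric.ball (0 : Space n) 1) := by
  unfold ballMass expWeight
  simp [Measure.real, Measure.addHaar_closedBall volume (0 : Space n) hr, ENNReal.toReal_mul,
    ENNReal.toReal_ofReal (pow_nonneg hr n)]

/-! ### Scalar comparison principles -/

lemma monotoneOn_of_hasDerivAt_nonneg {a b : ℝ} {f f' : ℝ → ℝ} (hf : ContinuousOn f (Icc a b))
    (hd : ∀ t ∈ Ioo a b, HasDerivAt f (f' t) t) (h0 : ∀ t ∈ Ioo a b, 0 ≤ f' t) :
    MonotoneOn f (Icc a b) := by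
  refine monotoneOn_of_deriv_nonneg (convex_Icc a b) hf ?_ ?_ <;> rw [interior_Icc]
  · exact fun t ht => (hd t ht).differentiableAt.differentiableWithinAt
  · exact fun t ht => by rw [(hd t ht).deriv]; exact h0 t ht

/-- A continuous function which cannot decrease while negative stays nonnegative. -/
lemma nonneg_of_deriv_nonneg_of_neg {a b : ℝ} {f f' : ℝ → ℝ} (hf : ContinuousOn f (Icc a b))
    (hd : ∀ t ∈ Ioo a b, HasDerivAt f (f' t) t) (h0 : ∀ t ∈ Ioo a b, f t < 0 → 0 ≤ f' t)
    (ha : 0 ≤ f a) : ∀ t ∈ Icc a b, 0 ≤ f t := by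
  intro t ht
  by_contra! hneg
  -- The greatest element `s` of `Z` is the last time before `t` at which `f ≥ 0`; beyond it `f` is
  -- negative, hence nondecreasing, so `f t ≥ f s`.
  set Z : Set ℝ := Icc a t ∩ f ⁻¹' Ici 0 with hZ
  have hsub : Icc a t ⊆ Icc a b := Icc_subset_Icc_right ht.2
  have hZc : IsCompact Z :=
    isCompact_Icc.of_isClosed_subset
      ((hf.mono hsub).preimage_isClosed_of_isClosed isClosed_Icc isClosed_Ici) inter_subset_left
  obtain ⟨s, hs, hmax⟩ := hZc.exists_isGreatest ⟨a, left_mem_Icc.2 ht.1, ha⟩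
  have hlt : ∀ r ∈ Ioo s t, f r < 0 := fun r hr => by
    by_contra! h
    exact absurd (hmax ⟨⟨hs.1.1.trans hr.1.le, hr.2.le⟩, h⟩) (not_le.2 hr.1)
  have hm : MonotoneOn f (Icc s t) := by
    have hsub2 : Ioo s t ⊆ Ioo a b := Ioo_subset_Ioo hs.1.1 ht.2
    exact monotoneOn_of_hasDerivAt_nonneg (hf.mono (Icc_subset_Icc hs.1.1 ht.2))
      (fun r hr => hd r (hsub2 hr)) fun r hr => h0 r (hsub2 hr) (hlt r hr)
  have := hm (left_mem_Icc.2 hs.1.2) (right_mem_Icc.2 hs.1.2) hs.1.2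
  have h5 : 0 ≤ f s := hs.2
  linarith

/-- The Riccati type inequality `H' ≥ K H^p t^(-σ)` bounds the length of the existence interval. -/
lemma riccati_bound {p K σ b : ℝ} {H H' S : ℝ → ℝ} (hp : 1 < p) (hb : 1 ≤ b)
    (hH : ContinuousOn H (Icc 1 b)) (hpos : ∀ t ∈ Icc 1 b, 0 < H t)
    (hd : ∀ t ∈ Ioo 1 b, HasDerivAt H (H' t) t)
    (hle : ∀ t ∈ Ioo 1 b, K * H t ^ p * t ^ (-σ) ≤ H' t)
    (hS : ∀ t : ℝ, 0 < t → HasDerivAt S (t ^ (-σ)) t) (hS1 : S 1 = 0) :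
    (p - 1) * K * S b ≤ H 1 ^ (1 - p) := by
  have hcS : ContinuousOn S (Icc 1 b) := fun t ht =>
    (hS t (by linarith [ht.1])).continuousAt.continuousWithinAt
  -- Separation of variables: `(-H^(1-p))' = (p-1) H^(-p) H' ≥ (p-1) K t^(-σ)`. Leaving the
  -- primitive `S` abstract treats powers and the logarithm together.
  have hm : MonotoneOn (fun t => -(H t ^ (1 - p)) - (p - 1) * K * S t) (Icc 1 b) := by
    refine monotoneOn_of_hasDerivAt_nonneg (f' := fun t =>
      -(H' t * (1 - p) * H t ^ (1 - p - 1)) - (p - 1) * K * t ^ (-σ)) ?_ ?_ ?_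
    · exact (hH.rpow_const fun t ht => Or.inl (hpos t ht).ne').neg.sub (hcS.const_mul _)
    · intro t ht
      exact ((hd t ht).rpow_const (Or.inl (hpos t (Ioo_subset_Icc_self ht)).ne')).neg.sub
        ((hS t (by linarith [ht.1])).const_mul _)
    · intro t ht
      have hHt := hpos t (Ioo_subset_Icc_self ht)
      have h1 := hle t ht
      have h2 : H t ^ (1 - p - 1) * H t ^ p = 1 := by
        rw [← Real.rpow_add hHt]; ring_nf; simp
      have h3 : 0 < H t ^ (1 - p - 1) := by positivity
      have h4 := mul_le_mul_of_nonneg_left h1 h3.le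
      have h5 : H t ^ (1 - p - 1) * (K * H t ^ p * t ^ (-σ)) = K * t ^ (-σ) := by
        linear_combination K * t ^ (-σ) * h2
      rw [h5] at h4
      nlinarith
  have h := hm (left_mem_Icc.2 hb) (right_mem_Icc.2 hb) hb
  have h6 : 0 < H b ^ (1 - p) := Real.rpow_pos_of_pos (hpos b (right_mem_Icc.2 hb)) _
  simp only [hS1] at h
  linarith

/-! ### The approximate Riccati solution and its multiplier -/

/-- The approximate logarithmic derivative used to factor the moment equation. -/
noncomputable def rate (α μ t : ℝ) : ℝ :=
  t ^ (-α) + (μ - α) / 2 * t⁻¹ - (1 - α) ^ 2 / 8 * t ^ (-(2 - α))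

/-- The derivative of `rate`. -/
noncomputable def rateDeriv (α μ t : ℝ) : ℝ :=
  -α * t ^ (-α - 1) + (μ - α) / 2 * (-(t ^ 2)⁻¹)
    - (1 - α) ^ 2 / 8 * (-(2 - α) * t ^ (-(2 - α) - 1))

lemma hasDerivAt_rate (α μ : ℝ) {t : ℝ} (ht : 0 < t) :
    HasDerivAt (rate α μ) (rateDeriv α μ t) t := by
  have h1 : HasDerivAt (fun t : ℝ => t ^ (-α)) (-α * t ^ (-α - 1)) t :=
    Real.hasDerivAt_rpow_const (Or.inl ht.ne')
  have h2 : HasDerivAt (fun t : ℝ => t ^ (-(2 - α))) (-(2 - α) * t ^ (-(2 - α) - 1)) t :=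
    Real.hasDerivAt_rpow_const (Or.inl ht.ne')
  exact (h1.add ((hasDerivAt_inv ht.ne').const_mul _)).sub (h2.const_mul _)

section Rate
variable {α μ t : ℝ}

/-- Writing `a = t^(-α)`, `y = 1/t` and `s = y/a ≤ 1` turns the estimates for `rate` into polynomial
inequalities. -/
lemma rpow_relations (hα₁ : α < 1) (ht : 1 ≤ t) :
    ∃ a y s : ℝ, 0 < a ∧ 0 < y ∧ 0 < s ∧ s ≤ 1 ∧ y = s * a ∧ t ^ (-α) = a ∧ t⁻¹ = y ∧
      t ^ (-(2 - α)) = y * s ∧ t ^ (-α - 1) = a * y ∧ t ^ (-(2 - α) - 1) = y ^ 2 * s ∧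
      t ^ (-(2 * α)) = a ^ 2 := by
  have ht0 : 0 < t := by linarith
  have hy : t⁻¹ = t ^ (-1 : ℝ) := (Real.rpow_neg_one t).symm
  refine ⟨t ^ (-α), t⁻¹, t ^ (α - 1), by positivity, by positivity, by positivity, ?_, ?_, rfl,
    rfl, ?_, ?_, ?_, ?_⟩
  · exact Real.rpow_le_one_of_one_le_of_nonpos ht (by linarith)
  · rw [hy, ← Real.rpow_add ht0]; ring_nf
  · rw [hy, ← Real.rpow_add ht0]; ring_nf
  · rw [hy, ← Real.rpow_add ht0]; ring_nf
  · rw [hy, ← Real.rpow_natCast, ← Real.rpow_mul ht0.le, ← Real.rpow_add ht0]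
    congr 1; push_cast; ring
  · rw [← Real.rpow_natCast, ← Real.rpow_mul ht0.le]; congr 1; push_cast; ring

lemma rate_pos (hα₀ : 0 ≤ α) (hα₁ : α < 1) (hμ : 0 ≤ μ) (ht : 1 ≤ t) : 0 < rate α μ t := by
  obtain ⟨a, y, s, ha, hy, hs, hs1, hys, e1, e2, e3, -⟩ := rpow_relations hα₁ ht
  rw [rate, e1, e2, e3]
  have hya : y ≤ a := by rw [hys]; nlinarith
  have h2 : y * s ≤ a := by nlinarith
  have h3 : (1 - α) ^ 2 / 8 ≤ 1 / 8 := by nlinarith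
  have h4 : (1 - α) ^ 2 / 8 * (y * s) ≤ 1 / 8 * a :=
    mul_le_mul h3 h2 (by positivity) (by norm_num)
  have h5 : -(1 / 2) * a ≤ (μ - α) / 2 * y := by nlinarith
  linarith

lemma rate_le (hα₀ : 0 ≤ α) (hα₁ : α < 1) (ht : 1 ≤ t) :
    rate α μ t ≤ (1 + |μ|) * t ^ (-α) := by
  obtain ⟨a, y, s, ha, hy, hs, hs1, hys, e1, e2, e3, -⟩ := rpow_relations hα₁ ht
  rw [rate, e1, e2, e3]
  have hya : y ≤ a := by rw [hys]; nlinarith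
  have h4 : 0 ≤ (1 - α) ^ 2 / 8 * (y * s) := by positivity
  have h5 : (μ - α) / 2 * y ≤ |μ| * a := by
    calc (μ - α) / 2 * y ≤ |μ| * y := by
          gcongr; linarith [le_abs_self μ, abs_nonneg μ]
      _ ≤ |μ| * a := by gcongr
  linarith

/-- The first two terms of `rate` cancel the residual at orders `t^(-2α)` and `t^(-α-1)`. The third
raises the coefficient of `t^(-2)` by `2γ`, with `γ = (1-α)²/8`. Since `(μ-α)(2-μ-α) = (1-α)² -
(1-μ)²`, that coefficient becomes `(1-μ)²/4 ≥ 0`, and the remainder is nonnegative as `γ s ≤ 2 -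
2α`. -/
lemma rate_supersolution (hα₀ : 0 ≤ α) (hα₁ : α < 1) (ht : 1 ≤ t) :
    0 ≤ rateDeriv α μ t + μ / t * rate α μ t - rate α μ t ^ 2 + t ^ (-(2 * α)) := by
  obtain ⟨a, y, s, ha, hy, hs, hs1, hys, e1, e2, e3, e4, e5, e6⟩ := rpow_relations hα₁ ht
  rw [rate, rateDeriv, div_eq_mul_inv μ t, ← inv_pow, e1, e2, e3, e4, e5, e6]
  set γ := (1 - α) ^ 2 / 8 with hγ
  have key : -α * (a * y) + (μ - α) / 2 * -y ^ 2 - γ * (-(2 - α) * (y ^ 2 * s))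
      + μ * y * (a + (μ - α) / 2 * y - γ * (y * s))
      - (a + (μ - α) / 2 * y - γ * (y * s)) ^ 2 + a ^ 2
      = y ^ 2 * ((2 * γ - (μ - α) * (2 - μ - α) / 4) + γ * s * (2 - 2 * α - γ * s)) := by
    rw [hys]; ring
  rw [key]
  have h1 : 0 ≤ 2 * γ - (μ - α) * (2 - μ - α) / 4 := by
    rw [hγ]; nlinarith [sq_nonneg (μ - 1)]
  have hγ0 : 0 ≤ γ := by positivity
  have hγ1 : γ ≤ 2 - 2 * α := by rw [hγ]; nlinarith
  have h2 : 0 ≤ 2 - 2 * α - γ * s := by nlinarith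
  positivity

end Rate

/-- The multiplier with logarithmic derivative `μ / t - rate α μ t`. -/
noncomputable def multiplier (α μ t : ℝ) : ℝ :=
  t ^ ((μ + α) / 2) * Real.exp ((1 - α) ^ 2 / 8 * lightDist (2 - α) t - lightDist α t)

lemma multiplier_one (α μ : ℝ) : multiplier α μ 1 = 1 := by simp [multiplier, lightDist_one]

lemma multiplier_pos (α μ : ℝ) {t : ℝ} (ht : 0 < t) : 0 < multiplier α μ t := by
  unfold multiplier; positivity

lemma hasDerivAt_multiplier {α : ℝ} (μ : ℝ) (hα₁ : α < 1) {t : ℝ} (ht : 0 < t) :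
    HasDerivAt (multiplier α μ) (multiplier α μ t * (μ / t - rate α μ t)) t := by
  have h1 : HasDerivAt (fun t : ℝ => t ^ ((μ + α) / 2)) ((μ + α) / 2 * t ^ ((μ + α) / 2 - 1)) t :=
    Real.hasDerivAt_rpow_const (Or.inl ht.ne')
  have h2 := ((hasDerivAt_lightDist (by linarith : 2 - α ≠ 1) ht).const_mul
    ((1 - α) ^ 2 / 8)).sub (hasDerivAt_lightDist hα₁.ne ht)
  refine (h1.mul h2.exp).congr_deriv ?_
  rw [Real.rpow_sub_one ht.ne', multiplier, rate]
  simp only [Pi.sub_apply]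
  field_simp
  ring

/-- The correction `t^(-(2-α))` is integrable at infinity with integral from `1` equal to `1/(1-α)`,
so it only costs a constant factor. -/
lemma multiplier_le {α μ t : ℝ} (hα₁ : α < 1) (ht : 1 ≤ t) :
    multiplier α μ t ≤ Real.exp ((1 - α) / 8) * (t ^ ((μ + α) / 2) * Real.exp (-lightDist α t)) := by
  have ht0 : 0 < t := by linarith
  have h1 : lightDist (2 - α) t ≤ 1 / (1 - α) := by
    have e : lightDist (2 - α) t = (1 - t ^ (1 - (2 - α))) / (1 - α) := by
      rw [lightDist, ← neg_div_neg_eq]; congr 1 <;> ring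
    rw [e]
    have : 0 < t ^ (1 - (2 - α)) := by positivity
    have h : 0 < 1 - α := by linarith
    gcongr; linarith
  have h2 : (1 - α) ^ 2 / 8 * lightDist (2 - α) t ≤ (1 - α) / 8 := by
    have h : 0 < 1 - α := by linarith
    calc (1 - α) ^ 2 / 8 * lightDist (2 - α) t ≤ (1 - α) ^ 2 / 8 * (1 / (1 - α)) := by gcongr
      _ = (1 - α) / 8 := by field_simp
  rw [multiplier, sub_eq_add_neg, Real.exp_add]
  have h3 : Real.exp ((1 - α) ^ 2 / 8 * lightDist (2 - α) t) ≤ Real.exp ((1 - α) / 8) :=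
    Real.exp_le_exp.2 h2
  calc _ = Real.exp ((1 - α) ^ 2 / 8 * lightDist (2 - α) t)
        * (t ^ ((μ + α) / 2) * Real.exp (-lightDist α t)) := by ring
    _ ≤ _ := by gcongr

/-! ### Blow-up inequalities for the moments -/

/-- Positivity for the moment equation with nonnegative data. -/
lemma moment_pos {α μ b : ℝ} {U V N : ℝ → ℝ}
    (cU : ContinuousOn U (Icc 1 b)) (cV : ContinuousOn V (Icc 1 b))
    (dU : ∀ t ∈ Ioo 1 b, HasDerivAt U (V t) t)
    (dV : ∀ t ∈ Ioo 1 b, HasDerivAt V (t ^ (-(2 * α)) * U t - μ / t * V t + N t) t)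
    (hN : ∀ t ∈ Icc 1 b, 0 ≤ N t) (hU1 : 0 ≤ U 1) (hV1 : 0 < V 1) :
    ∀ t ∈ Icc 1 b, 0 ≤ U t ∧ 0 < V t := by
  set P : ℝ → ℝ := fun t => t ^ μ * V t with hP
  have cP : ContinuousOn P (Icc 1 b) :=
    ((continuousOn_rpow_Ici μ).mono Icc_subset_Ici_self).mul cV
  have dP : ∀ t ∈ Ioo 1 b, HasDerivAt P (t ^ μ * (t ^ (-(2 * α)) * U t + N t)) t := fun t ht => by
    have ht0 : 0 < t := by linarith [ht.1]
    have h1 : HasDerivAt (fun t : ℝ => t ^ μ) (μ * t ^ (μ - 1)) t :=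
      Real.hasDerivAt_rpow_const (Or.inl ht0.ne')
    refine (h1.mul (dV t ht)).congr_deriv ?_
    rw [Real.rpow_sub_one ht0.ne']
    field_simp
    ring
  have pU : ∀ c ∈ Icc 1 b, (∀ t ∈ Ioo 1 c, 0 < P t) → ∀ t ∈ Icc 1 c, 0 ≤ U t := by
    intro c hc hpos t ht
    have hm : MonotoneOn U (Icc 1 c) :=
      monotoneOn_of_hasDerivAt_nonneg (cU.mono (Icc_subset_Icc_right hc.2))
        (fun r hr => dU r (Ioo_subset_Ioo_right hc.2 hr)) fun r hr => by
          have := hpos r hr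
          have hr0 : 0 < r := by linarith [hr.1]
          exact (pos_of_mul_pos_right this (by positivity)).le
    exact hU1.trans (hm (left_mem_Icc.2 hc.1) ht ht.1)
  have pP : ∀ t ∈ Icc 1 b, 0 < P t := by
    -- Continuity argument at the first time `c` with `P c ≤ 0`: before `c`, `V > 0` keeps `U ≥ 0`,
    -- so `P` is nondecreasing and `P c ≥ P 1 > 0`.
    by_contra! hne
    obtain ⟨t₁, ht₁, hneg⟩ := hne
    set Z : Set ℝ := Icc 1 b ∩ P ⁻¹' Iic 0 with hZ
    have hZc : IsCompact Z := isCompact_Icc.of_isClosed_subset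
      (cP.preimage_isClosed_of_isClosed isClosed_Icc isClosed_Iic) inter_subset_left
    obtain ⟨c, hc, hmin⟩ := hZc.exists_isLeast ⟨t₁, ht₁, hneg⟩
    have hpos : ∀ t ∈ Ioo 1 c, 0 < P t := fun r hr => by
      by_contra! h
      exact absurd (hmin ⟨⟨hr.1.le, hr.2.le.trans hc.1.2⟩, h⟩) (not_le.2 hr.2)
    have hU := pU c hc.1 hpos
    have hm : MonotoneOn P (Icc 1 c) :=
      monotoneOn_of_hasDerivAt_nonneg (cP.mono (Icc_subset_Icc_right hc.1.2))
        (fun r hr => dP r (Ioo_subset_Ioo_right hc.1.2 hr)) fun r hr => by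
          have hr0 : 0 < r := by linarith [hr.1]
          have := hU r (Ioo_subset_Icc_self hr)
          have := hN r ⟨hr.1.le, hr.2.le.trans hc.1.2⟩
          positivity
    have h1 := hm (left_mem_Icc.2 hc.1.1) (right_mem_Icc.2 hc.1.1) hc.1.1
    have h2 : P c ≤ 0 := hc.2
    have h3 : P 1 = V 1 := by simp [hP]
    linarith
  intro t ht
  have hb : b ∈ Icc 1 b := ⟨ht.1.trans ht.2, le_rfl⟩
  have ht0 : 0 < t := by linarith [ht.1]
  exact ⟨pU b hb (fun r hr => pP r (Ioo_subset_Icc_self hr)) t ht,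
    pos_of_mul_pos_right (pP t ht) (by positivity)⟩

/-- The comparison constant in the lower bound for the velocity moment. -/
noncomputable def comparisonConst (μ : ℝ) : ℝ := 1 / ((1 + |μ|) ^ 2 + 1)

lemma comparisonConst_pos (μ : ℝ) : 0 < comparisonConst μ := by
  unfold comparisonConst; positivity

lemma comparisonConst_le_one (μ : ℝ) : comparisonConst μ ≤ 1 := by
  unfold comparisonConst
  rw [div_le_one (by positivity)]
  nlinarith [sq_nonneg (1 + |μ|)]

/-- Lower bound of the velocity moment by the accumulated source term. -/
lemma velocity_moment_lower_bound {α μ b : ℝ} {U V N : ℝ → ℝ} (hα₀ : 0 ≤ α) (hα₁ : α < 1)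
    (hμ : 0 ≤ μ) (cU : ContinuousOn U (Icc 1 b)) (cV : ContinuousOn V (Icc 1 b))
    (dU : ∀ t ∈ Ioo 1 b, HasDerivAt U (V t) t)
    (dV : ∀ t ∈ Ioo 1 b, HasDerivAt V (t ^ (-(2 * α)) * U t - μ / t * V t + N t) t)
    (hN : ∀ t ∈ Icc 1 b, 0 ≤ N t) (hU1 : 0 ≤ U 1) (hV1 : 0 < V 1) {H : ℝ → ℝ}
    (cH : ContinuousOn H (Icc 1 b)) (dH : ∀ t ∈ Ioo 1 b, HasDerivAt H (multiplier α μ t * N t) t)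
    (hH1 : H 1 = V 1) (hb : 1 ≤ b) :
    ∀ t ∈ Icc 1 b, 0 < H t ∧ comparisonConst μ * H t ≤ multiplier α μ t * V t := by
  have hpos := moment_pos cU cV dU dV hN hU1 hV1
  set c := comparisonConst μ with hc
  have hc0 : 0 < c := comparisonConst_pos μ
  have hc1 : c ≤ 1 := comparisonConst_le_one μ
  have h0 : ∀ {t}, t ∈ Icc 1 b → 0 < t := fun ht => by linarith [ht.1]
  have cm : ContinuousOn (multiplier α μ) (Icc 1 b) := fun t ht =>
    (hasDerivAt_multiplier μ hα₁ (h0 ht)).continuousAt.continuousWithinAt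
  have ck : ContinuousOn (rate α μ) (Icc 1 b) := fun t ht =>
    (hasDerivAt_rate α μ (h0 ht)).continuousAt.continuousWithinAt
  have hHmono : MonotoneOn H (Icc 1 b) := monotoneOn_of_hasDerivAt_nonneg cH dH fun t ht => by
    have := hN t (Ioo_subset_Icc_self ht)
    have := multiplier_pos α μ (h0 (Ioo_subset_Icc_self ht))
    positivity
  have hHpos : ∀ t ∈ Icc 1 b, 0 < H t := fun t ht => by
    have := hHmono (left_mem_Icc.2 hb) ht ht.1
    linarith
  -- By the choice of the multiplier, `G' - m N` equals `m U` times the Riccati residual of `rate`,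
  -- which is nonnegative.
  set G : ℝ → ℝ := fun t => multiplier α μ t * (V t + rate α μ t * U t) with hG
  have hGH : ∀ t ∈ Icc 1 b, H t ≤ G t := by
    have hm : MonotoneOn (fun t => G t - H t) (Icc 1 b) := by
      refine monotoneOn_of_hasDerivAt_nonneg (f' := fun t => multiplier α μ t * U t *
        (rateDeriv α μ t + μ / t * rate α μ t - rate α μ t ^ 2 + t ^ (-(2 * α)))) ?_ ?_ ?_
      · exact (cm.mul (cV.add (ck.mul cU))).sub cH
      · intro t ht
        have ht0 := h0 (Ioo_subset_Icc_self ht)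
        refine (((hasDerivAt_multiplier μ hα₁ ht0).mul ((dV t ht).add
          ((hasDerivAt_rate α μ ht0).mul (dU t ht)))).sub (dH t ht)).congr_deriv ?_
        simp only [Pi.add_apply, Pi.mul_apply]
        ring
      · intro t ht
        have ht' := Ioo_subset_Icc_self ht
        have h1 := rate_supersolution (μ := μ) hα₀ hα₁ ht.1.le
        have h2 := (hpos t ht').1
        have h3 := multiplier_pos α μ (h0 ht')
        positivity
    intro t ht
    have h1 := hm (left_mem_Icc.2 hb) ht ht.1
    have h2 : 0 ≤ G 1 - H 1 := by
      have := (rate_pos hα₀ hα₁ hμ (le_refl 1)).le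
      simp only [hG, hH1, multiplier_one]
      nlinarith [mul_nonneg this hU1]
    dsimp only at h1
    linarith
  -- `H ≤ G` still involves `U`. To bound `V` alone, `m V - c H` is shown to be unable to decrease
  -- while negative: if `V` is small, then `H ≤ G` forces `U` to be large, and the term `t^(-2α) U`
  -- pushes `V` up.
  have hD := nonneg_of_deriv_nonneg_of_neg
    (f := fun t => multiplier α μ t * V t - c * H t)
    (f' := fun t => multiplier α μ t * (μ / t - rate α μ t) * V t + multiplier α μ t *
      (t ^ (-(2 * α)) * U t - μ / t * V t + N t) - c * (multiplier α μ t * N t))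
    ((cm.mul cV).sub (cH.const_mul c))
    (fun t ht => ((hasDerivAt_multiplier μ hα₁ (h0 (Ioo_subset_Icc_self ht))).mul
      (dV t ht)).sub ((dH t ht).const_mul c)) ?_ ?_
  · intro t ht
    have := hD t ht
    exact ⟨hHpos t ht, by linarith⟩
  · intro t ht hneg
    have ht' := Ioo_subset_Icc_self ht
    have hk := rate_pos hα₀ hα₁ hμ ht.1.le
    have hk' := rate_le (μ := μ) hα₀ hα₁ ht.1.le
    have hGt := hGH t ht'
    have hm := multiplier_pos α μ (h0 ht')
    have hNt := hN t ht'
    have hHt := hHpos t ht'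
    obtain ⟨a, -, -, ha, -, -, -, -, e1, -, -, -, -, e6⟩ := rpow_relations hα₁ ht.1.le
    simp only [hG] at hGt
    rw [e6]
    rw [e1] at hk'
    set k := rate α μ t with hkdef
    set m := multiplier α μ t with hmdef
    -- `comparisonConst` is chosen for this inequality, given `k ≤ (1 + |μ|) a`.
    have hcc : c * (k ^ 2 + a ^ 2) ≤ a ^ 2 := by
      have h1 : k ^ 2 + a ^ 2 ≤ ((1 + |μ|) ^ 2 + 1) * a ^ 2 := by
        have : k ^ 2 ≤ ((1 + |μ|) * a) ^ 2 := by gcongr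
        nlinarith
      calc c * (k ^ 2 + a ^ 2) ≤ c * (((1 + |μ|) ^ 2 + 1) * a ^ 2) := by gcongr
        _ = a ^ 2 := by rw [hc, comparisonConst]; field_simp
    -- Multiplying by `k > 0` makes `k U` appear, so that `H ≤ G` applies; each of the four
    -- resulting terms is nonnegative.
    have hmul : 0 ≤ k * (m * (μ / t - k) * V t + m * (a ^ 2 * U t - μ / t * V t + N t)
        - c * (m * N t)) := by
      have e : k * (m * (μ / t - k) * V t + m * (a ^ 2 * U t - μ / t * V t + N t) - c * (m * N t))
          = k * ((1 - c) * (m * N t)) + a ^ 2 * (m * (V t + k * U t) - H t)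
            + (k ^ 2 + a ^ 2) * (c * H t - m * V t) + (a ^ 2 - c * (k ^ 2 + a ^ 2)) * H t := by
        ring
      rw [e]
      have t1 : 0 ≤ k * ((1 - c) * (m * N t)) := by
        have : 0 ≤ 1 - c := by linarith
        positivity
      have t2 : 0 ≤ a ^ 2 * (m * (V t + k * U t) - H t) :=
        mul_nonneg (sq_nonneg a) (by linarith)
      have t3 : 0 ≤ (k ^ 2 + a ^ 2) * (c * H t - m * V t) :=
        mul_nonneg (by positivity) (by linarith)
      have t4 : 0 ≤ (a ^ 2 - c * (k ^ 2 + a ^ 2)) * H t := mul_nonneg (by linarith) hHt.le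
      linarith
    exact nonneg_of_mul_nonneg_right hmul hk
  · simp only [multiplier_one, hH1]
    nlinarith

/-- The exponential moments satisfy a Riccati type bound. -/
lemma exponential_moment_bound {α μ p b C σ : ℝ} {U V N Φ S : ℝ → ℝ} (hα₀ : 0 ≤ α) (hα₁ : α < 1)
    (hμ : 0 ≤ μ) (hp : 1 < p) (hC : 0 < C) (cU : ContinuousOn U (Icc 1 b))
    (cV : ContinuousOn V (Icc 1 b)) (cN : ContinuousOn N (Icc 1 b))
    (dU : ∀ t ∈ Ioo 1 b, HasDerivAt U (V t) t)
    (dV : ∀ t ∈ Ioo 1 b, HasDerivAt V (t ^ (-(2 * α)) * U t - μ / t * V t + N t) t)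
    (hU1 : 0 ≤ U 1) (hV1 : 0 < V 1) (hb : 1 ≤ b)
    (hΦ : ∀ t ∈ Icc 1 b, 0 < Φ t)
    (hN : ∀ t ∈ Icc 1 b, |V t| ^ p ≤ N t * Φ t ^ (p - 1))
    (hmΦ : ∀ t ∈ Icc 1 b, (multiplier α μ t * Φ t) ^ (p - 1) ≤ C * t ^ σ)
    (hS : ∀ t : ℝ, 0 < t → HasDerivAt S (t ^ (-σ)) t) (hS1 : S 1 = 0) :
    (p - 1) * (comparisonConst μ ^ p / C) * S b ≤ V 1 ^ (1 - p) := by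
  have hN0 : ∀ t ∈ Icc 1 b, 0 ≤ N t := fun t ht => by
    have h1 := hN t ht
    have h2 := Real.rpow_pos_of_pos (hΦ t ht) (p - 1)
    by_contra! h
    have h3 : 0 ≤ |V t| ^ p := by positivity
    nlinarith
  have h0 : ∀ {t}, t ∈ Icc 1 b → 0 < t := fun ht => by linarith [ht.1]
  have cm : ContinuousOn (multiplier α μ) (Icc 1 b) := fun t ht =>
    (hasDerivAt_multiplier μ hα₁ (h0 ht)).continuousAt.continuousWithinAt
  have cmN : ContinuousOn (fun t => multiplier α μ t * N t) (Icc 1 b) := cm.mul cN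
  set H : ℝ → ℝ := fun t => V 1 + ∫ s in (1 : ℝ)..t, multiplier α μ s * N s with hH
  have cH : ContinuousOn H (Icc 1 b) := by
    refine continuousOn_const.add ?_
    have := intervalIntegral.continuousOn_primitive_interval (μ := volume) (a := 1) (b := b)
      (f := fun t => multiplier α μ t * N t) (by
        rw [uIcc_of_le hb]; exact cmN.integrableOn_compact isCompact_Icc)
    rwa [uIcc_of_le hb] at this
  have dH : ∀ t ∈ Ioo 1 b, HasDerivAt H (multiplier α μ t * N t) t := fun t ht => by
    have hnh : Icc 1 b ∈ 𝓝 t := Icc_mem_nhds ht.1 ht.2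
    refine (intervalIntegral.integral_hasDerivAt_right ?_ ?_ ?_).const_add _
    · refine ContinuousOn.intervalIntegrable ?_
      rw [uIcc_of_le ht.1.le]
      exact cmN.mono (Icc_subset_Icc_right ht.2.le)
    · exact ContinuousOn.stronglyMeasurableAtFilter_nhdsWithin
        (cmN.mono Ioo_subset_Icc_self) measurableSet_Ioo t |>.filter_mono
          (by rw [isOpen_Ioo.nhdsWithin_eq ht])
    · exact cmN.continuousAt hnh
  have hH1 : H 1 = V 1 := by simp [hH]
  have hlow := velocity_moment_lower_bound hα₀ hα₁ hμ cU cV dU dV hN0 hU1 hV1 cH dH hH1 hb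
  have hc0 := comparisonConst_pos μ
  rw [← hH1]
  refine riccati_bound hp hb cH (fun t ht => (hlow t ht).1) dH ?_ hS hS1
  intro t ht'
  have ht := Ioo_subset_Icc_self ht'
  have ht0 := h0 ht
  have hm := multiplier_pos α μ ht0
  obtain ⟨hHt, hlt⟩ := hlow t ht
  set m := multiplier α μ t with hmdef
  set c := comparisonConst μ with hcdef
  have hVt : 0 < V t := by
    have : 0 < m * V t := lt_of_lt_of_le (by positivity) hlt
    exact pos_of_mul_pos_right this hm.le
  have h1 : (c * H t) ^ p ≤ (m * V t) ^ p := by gcongr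
  -- Hölder's bound in the form `(m V)^p ≤ m N (m Φ)^(p-1)`: one factor `m` stays with `N` to form
  -- `H'`, the others go to `Φ`.
  have h2 : (m * V t) ^ p ≤ m * N t * (C * t ^ σ) := by
    have e1 : m ^ p = m * m ^ (p - 1) := by
      rw [Real.rpow_sub_one hm.ne']; field_simp
    have h3 := hN t ht
    rw [abs_of_pos hVt] at h3
    calc (m * V t) ^ p = m * m ^ (p - 1) * V t ^ p := by
          rw [Real.mul_rpow hm.le hVt.le, e1]
      _ ≤ m * m ^ (p - 1) * (N t * Φ t ^ (p - 1)) := by gcongr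
      _ = m * N t * (m * Φ t) ^ (p - 1) := by
          rw [Real.mul_rpow hm.le (hΦ t ht).le]; ring
      _ ≤ m * N t * (C * t ^ σ) := by
          have := hN0 t ht
          have := hmΦ t ht
          gcongr
  rw [Real.mul_rpow hc0.le hHt.le] at h1
  have hts : 0 < t ^ σ := by positivity
  calc c ^ p / C * H t ^ p * t ^ (-σ) = (c ^ p * H t ^ p) / (C * t ^ σ) := by
        rw [Real.rpow_neg ht0.le]; field_simp
    _ ≤ m * N t := by
        rw [div_le_iff₀ (by positivity)]
        exact h1.trans h2

/-- The unweighted moments satisfy a Riccati type bound. -/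
lemma plain_moment_bound {μ p b C q : ℝ} {V N Φ S : ℝ → ℝ}
    (hp : 1 < p) (hC : 0 < C) (cV : ContinuousOn V (Icc 1 b))
    (dV : ∀ t ∈ Ioo 1 b, HasDerivAt V (-(μ / t * V t) + N t) t)
    (hV1 : 0 < V 1) (hb : 1 ≤ b) (hΦ : ∀ t ∈ Icc 1 b, 0 < Φ t)
    (hN : ∀ t ∈ Icc 1 b, |V t| ^ p ≤ N t * Φ t ^ (p - 1))
    (hmΦ : ∀ t ∈ Icc 1 b, Φ t ^ (p - 1) ≤ C * t ^ q)
    (hS : ∀ t : ℝ, 0 < t → HasDerivAt S (t ^ (-(μ * (p - 1) + q))) t) (hS1 : S 1 = 0) :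
    (p - 1) * (1 / C) * S b ≤ V 1 ^ (1 - p) := by
  have hN0 : ∀ t ∈ Icc 1 b, 0 ≤ N t := fun t ht => by
    have h1 := hN t ht
    have h2 := Real.rpow_pos_of_pos (hΦ t ht) (p - 1)
    by_contra! h
    have h3 : 0 ≤ |V t| ^ p := by positivity
    nlinarith
  -- The integrating factor `t ^ μ` removes the damping: `P' = t ^ μ N`.
  set P : ℝ → ℝ := fun t => t ^ μ * V t with hP
  have h0 : ∀ {t}, t ∈ Icc 1 b → 0 < t := fun ht => by linarith [ht.1]
  have cP : ContinuousOn P (Icc 1 b) :=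
    ((continuousOn_rpow_Ici μ).mono Icc_subset_Ici_self).mul cV
  have dP : ∀ t ∈ Ioo 1 b, HasDerivAt P (t ^ μ * N t) t := fun t ht => by
    have ht0 : 0 < t := by linarith [ht.1]
    have h1 : HasDerivAt (fun t : ℝ => t ^ μ) (μ * t ^ (μ - 1)) t :=
      Real.hasDerivAt_rpow_const (Or.inl ht0.ne')
    refine (h1.mul (dV t ht)).congr_deriv ?_
    rw [Real.rpow_sub_one ht0.ne']
    field_simp
    ring
  have hP1 : P 1 = V 1 := by simp [hP]
  have hmono : MonotoneOn P (Icc 1 b) := monotoneOn_of_hasDerivAt_nonneg cP dP fun t ht => by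
    have := hN0 t (Ioo_subset_Icc_self ht)
    have := h0 (Ioo_subset_Icc_self ht)
    positivity
  have hpos : ∀ t ∈ Icc 1 b, 0 < P t := fun t ht => by
    have := hmono (left_mem_Icc.2 hb) ht ht.1
    linarith
  rw [← hP1]
  refine riccati_bound hp hb cP hpos dP ?_ hS hS1
  intro t ht'
  have ht := Ioo_subset_Icc_self ht'
  have ht0 := h0 ht
  have hVt : 0 < V t := pos_of_mul_pos_right (hpos t ht) (by positivity)
  have h1 : V t ^ p ≤ N t * (C * t ^ q) := by
    have h3 := hN t ht
    rw [abs_of_pos hVt] at h3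
    have := hN0 t ht
    exact h3.trans (by gcongr; exact hmΦ t ht)
  have e : 1 / C * P t ^ p * t ^ (-(μ * (p - 1) + q)) = t ^ μ * (V t ^ p / (C * t ^ q)) := by
    have e1 : P t ^ p = t ^ (μ * p) * V t ^ p := by
      rw [hP]; dsimp only
      rw [Real.mul_rpow (by positivity) hVt.le, ← Real.rpow_mul ht0.le]
    have e2 : t ^ (μ * p) * t ^ (-(μ * (p - 1) + q)) = t ^ μ * (t ^ q)⁻¹ := by
      rw [← Real.rpow_neg ht0.le, ← Real.rpow_add ht0, ← Real.rpow_add ht0]; ring_nf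
    rw [e1]
    calc _ = 1 / C * V t ^ p * (t ^ (μ * p) * t ^ (-(μ * (p - 1) + q))) := by ring
      _ = _ := by rw [e2]; field_simp
  rw [e]
  gcongr
  rw [div_le_iff₀ (by positivity)]
  exact h1

/-! ### Growth in time of the weight masses -/

lemma radius_le {α R t : ℝ} (hα₁ : α < 1) (hR : 0 < R) (ht : 1 ≤ t) :
    R + lightDist α t ≤ (R + 1 / (1 - α)) * t ^ (1 - α) := by
  have h : 0 < 1 - α := by linarith
  have h1 : 1 ≤ t ^ (1 - α) := Real.one_le_rpow ht h.le
  have h2 : R ≤ R * t ^ (1 - α) := by nlinarith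
  have h3 : lightDist α t ≤ 1 / (1 - α) * t ^ (1 - α) := by
    unfold lightDist
    rw [one_div_mul_eq_div]
    gcongr
    linarith
  linarith

/-- The factor `exp (-A(t))` of the multiplier cancels `exp (R + A(t))` from the ball mass up to a
constant. What remains is `t^((μ+α)/2)` times the radius, of order at most `t^(1-α)`, to the power
`(n-1)/2`. -/
lemma exists_multiplier_mul_ballMass_le {n : ℕ} (hn : 1 ≤ n) (i : Fin n) {α μ p R : ℝ}
    (hα₁ : α < 1) (hp : 1 < p) (hR : 0 < R) :
    ∃ C : ℝ, 0 < C ∧ ∀ t : ℝ, 1 ≤ t →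
      (multiplier α μ t * ballMass n 1 i (R + lightDist α t)) ^ (p - 1)
        ≤ C * t ^ (((1 - α) * ((n : ℝ) - 1) + μ + α) * (p - 1) / 2) := by
  have hα : 0 < 1 - α := by linarith
  set L := R + 1 / (1 - α) with hL
  have hLpos : 0 < L := by positivity
  set C₁ := Real.exp ((1 - α) / 8) * (2 * Real.exp R * √(4 * Real.pi * L) ^ (n - 1)) with hC₁
  have hC₁pos : 0 < C₁ := by
    have : 0 < √(4 * Real.pi * L) := Real.sqrt_pos.2 (by positivity)
    positivity
  refine ⟨C₁ ^ (p - 1), by positivity, fun t ht => ?_⟩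
  have ht0 : 0 < t := by linarith
  have hr : 0 < R + lightDist α t := by linarith [lightDist_nonneg hα₁ ht]
  have hm := multiplier_le (μ := μ) hα₁ ht
  have hm0 := multiplier_pos α μ ht0
  have hb0 := ballMass_pos (κ := 1) (i := i) hr
  have hsq : √(4 * Real.pi * (R + lightDist α t)) ^ (n - 1)
      ≤ √(4 * Real.pi * L) ^ (n - 1) * t ^ ((1 - α) * ((n : ℝ) - 1) / 2) := by
    have h1 : √(4 * Real.pi * (R + lightDist α t)) ≤ √(4 * Real.pi * L) * t ^ ((1 - α) / 2) := by
      have e : t ^ ((1 - α) / 2) = √(t ^ (1 - α)) := by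
        rw [Real.sqrt_eq_rpow, ← Real.rpow_mul ht0.le]; ring_nf
      rw [e, ← Real.sqrt_mul (by positivity)]
      apply Real.sqrt_le_sqrt
      rw [mul_assoc (4 * Real.pi)]
      gcongr
      exact radius_le hα₁ hR ht
    calc _ ≤ (√(4 * Real.pi * L) * t ^ ((1 - α) / 2)) ^ (n - 1) := by gcongr
      _ = _ := by
        rw [mul_pow, ← Real.rpow_natCast (t ^ ((1 - α) / 2)), ← Real.rpow_mul ht0.le,
          Nat.cast_sub hn]
        congr 2; push_cast; ring
  have key : multiplier α μ t * ballMass n 1 i (R + lightDist α t)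
      ≤ C₁ * t ^ (((1 - α) * ((n : ℝ) - 1) + μ + α) / 2) := by
    calc _ ≤ (Real.exp ((1 - α) / 8) * (t ^ ((μ + α) / 2) * Real.exp (-lightDist α t)))
          * (2 * Real.exp (R + lightDist α t) * √(4 * Real.pi * (R + lightDist α t)) ^ (n - 1)) := by
          gcongr
          exact ballMass_one_le i hr
      _ ≤ (Real.exp ((1 - α) / 8) * (t ^ ((μ + α) / 2) * Real.exp (-lightDist α t)))
          * (2 * Real.exp (R + lightDist α t) *
            (√(4 * Real.pi * L) ^ (n - 1) * t ^ ((1 - α) * ((n : ℝ) - 1) / 2))) := by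
          gcongr
      _ = C₁ * t ^ (((1 - α) * ((n : ℝ) - 1) + μ + α) / 2) := by
          have e1 : t ^ (((1 - α) * ((n : ℝ) - 1) + μ + α) / 2)
              = t ^ ((μ + α) / 2) * t ^ ((1 - α) * ((n : ℝ) - 1) / 2) := by
            rw [← Real.rpow_add ht0]; ring_nf
          have e2 : Real.exp (-lightDist α t) * Real.exp (lightDist α t) = 1 := by
            rw [← Real.exp_add]; simp
          rw [e1, hC₁, Real.exp_add]
          linear_combination (Real.exp ((1 - α) / 8) * t ^ ((μ + α) / 2) * 2 * Real.exp R *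
            √(4 * Real.pi * L) ^ (n - 1) * t ^ ((1 - α) * ((n : ℝ) - 1) / 2)) * e2
  calc _ ≤ (C₁ * t ^ (((1 - α) * ((n : ℝ) - 1) + μ + α) / 2)) ^ (p - 1) := by gcongr
    _ = _ := by
      rw [Real.mul_rpow hC₁pos.le (by positivity), ← Real.rpow_mul ht0.le]
      congr 2; ring

lemma exists_ballMass_zero_le {n : ℕ} (i : Fin n) {α p R : ℝ}
    (hα₁ : α < 1) (hp : 1 < p) (hR : 0 < R) :
    ∃ C : ℝ, 0 < C ∧ ∀ t : ℝ, 1 ≤ t →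
      ballMass n 0 i (R + lightDist α t) ^ (p - 1) ≤ C * t ^ ((n : ℝ) * (1 - α) * (p - 1)) := by
  have hα : 0 < 1 - α := by linarith
  set L := R + 1 / (1 - α) with hL
  have hLpos : 0 < L := by positivity
  set ω := volume.real (Metric.ball (0 : Space n) 1) with hω
  have hωpos : 0 < ω := by
    have h := ballMass_pos (n := n) (κ := 0) (i := i) (r := 1) one_pos
    rw [ballMass_zero i zero_le_one] at h
    simpa using h
  refine ⟨(L ^ n * ω) ^ (p - 1), by positivity, fun t ht => ?_⟩
  have ht0 : 0 < t := by linarith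
  have hr : 0 ≤ R + lightDist α t := by linarith [lightDist_nonneg hα₁ ht]
  rw [ballMass_zero i hr]
  calc ((R + lightDist α t) ^ n * ω) ^ (p - 1)
      ≤ ((L * t ^ (1 - α)) ^ n * ω) ^ (p - 1) := by
        gcongr
        exact radius_le hα₁ hR ht
    _ = (L ^ n * ω * t ^ ((n : ℝ) * (1 - α))) ^ (p - 1) := by
        rw [mul_pow, ← Real.rpow_natCast (t ^ (1 - α)), ← Real.rpow_mul ht0.le]
        congr 1; ring_nf
    _ = _ := by
        rw [Real.mul_rpow (by positivity) (by positivity), ← Real.rpow_mul ht0.le]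

/-! ### Initial moments -/

section Data

variable {n : ℕ} {R : ℝ} {u₀ u₁ : Space n → ℝ}

lemma moment_const_mul (κ ε : ℝ) (i : Fin n) (f : Space n → ℝ) :
    moment κ i (fun x => ε * f x) = ε * moment κ i f := by
  unfold moment
  rw [← integral_const_mul]
  exact integral_congr_ae (Eventually.of_forall fun x => by dsimp only; ring)

lemma moment_nonneg {κ : ℝ} {i : Fin n} {f : Space n → ℝ} (hf : ∀ x, 0 ≤ f x) :
    0 ≤ moment κ i f :=
  integral_nonneg fun x => mul_nonneg (hf x) (expWeight_pos x).le

/-- A zero moment forces `u₁ = 0`, and then `0 ≤ u₀ ≤ u₁` forces `u₀ = 0`, contradicting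
nontriviality. -/
lemma moment_initial_velocity_pos (κ : ℝ) (i : Fin n) (hu₁ : Continuous u₁)
    (hnontriv : ¬ (u₀ = 0 ∧ u₁ = 0)) (hsign : ∀ x, 0 ≤ u₀ x ∧ u₀ x ≤ u₁ x)
    (hsupp₁ : tsupport u₁ ⊆ Metric.closedBall 0 R) : 0 < moment κ i u₁ := by
  have h1 : ∀ x, 0 ≤ u₁ x := fun x => (hsign x).1.trans (hsign x).2
  refine (moment_nonneg h1).lt_of_ne fun h => hnontriv ?_
  have hz : ∀ x, u₁ x = 0 := fun x => by
    have := eq_zero_of_integral_eq_zero (isCompact_closedBall (0 : Space n) R)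
      (hu₁.mul (continuous_expWeight (κ := κ) (i := i)))
      (fun x hx => by simp [initial_u_eq_zero hsupp₁ (by simpa using hx : R < ‖x‖)])
      (fun x => mul_nonneg (h1 x) (expWeight_pos x).le) h.symm x
    exact (mul_eq_zero.1 this).resolve_right (expWeight_pos x).ne'
  exact ⟨funext fun x => le_antisymm ((hsign x).2.trans_eq (hz x)) (hsign x).1, funext hz⟩

end Data

/-! ### Bounds on the existence time -/

section Lifespan

variable {n : ℕ} {α μ p R : ℝ} {u₀ u₁ : Space n → ℝ}

lemma rpow_mul_const_aux {ε m K p : ℝ} (hε : 0 < ε) (hm : 0 < m) {s : ℝ}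
    (h : K * s ≤ (ε * m) ^ (1 - p)) : K / m ^ (1 - p) * s ≤ ε ^ (1 - p) := by
  have hm' : 0 < m ^ (1 - p) := by positivity
  rw [Real.mul_rpow hε.le hm.le] at h
  rw [div_mul_eq_mul_div, div_le_iff₀ hm']
  exact h

/-- A priori restriction on the existence time from the exponential moment. -/
lemma exists_exponential_time_bound (hn : 2 ≤ n) (hα₀ : 0 ≤ α) (hα₁ : α < 1)
    (hμ : 0 ≤ μ) (hp : 1 < p) (hR : 0 < R) (hu₁ : Continuous u₁)
    (hnontriv : ¬ (u₀ = 0 ∧ u₁ = 0)) (hsign : ∀ x, 0 ≤ u₀ x ∧ u₀ x ≤ u₁ x)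
    (hsupp₀ : tsupport u₀ ⊆ Metric.closedBall 0 R)
    (hsupp₁ : tsupport u₁ ⊆ Metric.closedBall 0 R) :
    ∃ K : ℝ, 0 < K ∧ ∀ ε : ℝ, 0 < ε → ∀ (T : EReal) (u : ℝ → Space n → ℝ),
      IsClassicalSolution α μ p u₀ u₁ ε T u → ∀ S : ℝ → ℝ, S 1 = 0 →
      (∀ t : ℝ, 0 < t → HasDerivAt S
        (t ^ (-(((1 - α) * ((n : ℝ) - 1) + μ + α) * (p - 1) / 2))) t) →
      ∀ t : ℝ, 1 ≤ t → (t : EReal) < T → K * S t ≤ ε ^ (1 - p) := by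
  set i : Fin n := ⟨0, by omega⟩
  obtain ⟨C, hC, hCb⟩ := exists_multiplier_mul_ballMass_le (by omega : 1 ≤ n) i (μ := μ) hα₁ hp hR
  have hm := moment_initial_velocity_pos 1 i hu₁ hnontriv hsign hsupp₁
  have hc := comparisonConst_pos μ
  -- The initial velocity moment is `ε` times that of `u₁`, so dividing by the latter to the power
  -- `1 - p` isolates `ε ^ (1 - p)` and leaves `K` independent of `ε` and of the solution.
  refine ⟨(p - 1) * (comparisonConst μ ^ p / C) / moment 1 i u₁ ^ (1 - p), ?_, ?_⟩
  · have : 0 < p - 1 := by linarith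
    positivity
  intro ε hε T u hu S hS1 hS b hb hbT
  obtain ⟨ut, utt, g, gt, gx, j⟩ := hu.exists_jet
  obtain ⟨cU, cV, cN, dU, dV, hN⟩ := j.moment_ode hα₀ hα₁ hμ hp hR hsupp₀ hsupp₁ 1 i
  have hlt : ∀ {t}, t ≤ b → (t : EReal) < T := fun h =>
    lt_of_le_of_lt (EReal.coe_le_coe_iff.2 h) hbT
  have hU1 : moment 1 i (u 1) = ε * moment 1 i u₀ := by
    rw [← moment_const_mul]; exact congrArg _ (funext j.initial_u)
  have hV1 : moment 1 i (ut 1) = ε * moment 1 i u₁ := by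
    rw [← moment_const_mul]; exact congrArg _ (funext j.initial_ut)
  have h := exponential_moment_bound hα₀ hα₁ hμ hp hC (cU b hbT) (cV b hbT) (cN b hbT)
    (Φ := fun t => ballMass n 1 i (R + lightDist α t))
    (fun t ht => dU t ht.1 (hlt ht.2.le))
    (fun t ht => by simpa using dV t ht.1 (hlt ht.2.le))
    (by rw [hU1]; exact mul_nonneg hε.le (moment_nonneg fun x => (hsign x).1))
    (by rw [hV1]; positivity) hb
    (fun t ht => ballMass_pos (by linarith [lightDist_nonneg hα₁ ht.1]))
    (fun t ht => hN t ht.1 (hlt ht.2)) (fun t ht => hCb t ht.1) hS hS1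
  rw [hV1] at h
  exact rpow_mul_const_aux hε hm h

/-- A priori restriction on the existence time from the unweighted moment. -/
lemma exists_plain_time_bound (hn : 2 ≤ n) (hα₀ : 0 ≤ α) (hα₁ : α < 1)
    (hμ : 0 ≤ μ) (hp : 1 < p) (hR : 0 < R) (hu₁ : Continuous u₁)
    (hnontriv : ¬ (u₀ = 0 ∧ u₁ = 0)) (hsign : ∀ x, 0 ≤ u₀ x ∧ u₀ x ≤ u₁ x)
    (hsupp₀ : tsupport u₀ ⊆ Metric.closedBall 0 R)
    (hsupp₁ : tsupport u₁ ⊆ Metric.closedBall 0 R) :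
    ∃ K : ℝ, 0 < K ∧ ∀ ε : ℝ, 0 < ε → ∀ (T : EReal) (u : ℝ → Space n → ℝ),
      IsClassicalSolution α μ p u₀ u₁ ε T u → ∀ S : ℝ → ℝ, S 1 = 0 →
      (∀ t : ℝ, 0 < t → HasDerivAt S (t ^ (-((p - 1) * ((n : ℝ) * (1 - α) + μ)))) t) →
      ∀ t : ℝ, 1 ≤ t → (t : EReal) < T → K * S t ≤ ε ^ (1 - p) := by
  set i : Fin n := ⟨0, by omega⟩
  obtain ⟨C, hC, hCb⟩ := exists_ballMass_zero_le i hα₁ hp hR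
  have hm := moment_initial_velocity_pos 0 i hu₁ hnontriv hsign hsupp₁
  refine ⟨(p - 1) * (1 / C) / moment 0 i u₁ ^ (1 - p), ?_, ?_⟩
  · have : 0 < p - 1 := by linarith
    positivity
  intro ε hε T u hu S hS1 hS b hb hbT
  obtain ⟨ut, utt, g, gt, gx, j⟩ := hu.exists_jet
  obtain ⟨cU, cV, cN, dU, dV, hN⟩ := j.moment_ode hα₀ hα₁ hμ hp hR hsupp₀ hsupp₁ 0 i
  have hlt : ∀ {t}, t ≤ b → (t : EReal) < T := fun h =>
    lt_of_le_of_lt (EReal.coe_le_coe_iff.2 h) hbT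
  have hV1 : moment 0 i (ut 1) = ε * moment 0 i u₁ := by
    rw [← moment_const_mul]; exact congrArg _ (funext j.initial_ut)
  have h := plain_moment_bound (μ := μ) hp hC (cV b hbT)
    (Φ := fun t => ballMass n 0 i (R + lightDist α t))
    (N := fun t => moment 0 i fun x => |ut t x| ^ p)
    (fun t ht => by simpa using dV t ht.1 (hlt ht.2.le))
    (by rw [hV1]; positivity) hb
    (fun t ht => ballMass_pos (by linarith [lightDist_nonneg hα₁ ht.1]))
    (fun t ht => hN t ht.1 (hlt ht.2)) (fun t ht => hCb t ht.1)
    (fun t ht => by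
      convert hS t ht using 2; ring) hS1
  rw [hV1] at h
  exact rpow_mul_const_aux hε hm h

lemma le_of_rpow_time_bound {K σ t y : ℝ} (hK : 0 < K) (hσ : σ < 1) (ht : 1 ≤ t)
    (h : K * lightDist σ t ≤ y) : t ≤ (1 + (1 - σ) / K * y) ^ (1 / (1 - σ)) := by
  have hσ' : 0 < 1 - σ := by linarith
  have ht0 : 0 < t := by linarith
  have h1 : t ^ (1 - σ) ≤ 1 + (1 - σ) / K * y := by
    have h2 : t ^ (1 - σ) = 1 + (1 - σ) * lightDist σ t := by
      unfold lightDist; field_simp; ring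
    rw [h2]
    have : (1 - σ) * lightDist σ t = (1 - σ) / K * (K * lightDist σ t) := by field_simp
    rw [this]
    gcongr
  calc t = (t ^ (1 - σ)) ^ (1 / (1 - σ)) := by
        rw [← Real.rpow_mul ht0.le, mul_one_div_cancel hσ'.ne', Real.rpow_one]
    _ ≤ _ := by gcongr

/-- For `ε ≤ 1` one has `1 ≤ ε ^ (1 - p)`, so the additive `1` is absorbed into the power of `ε`. -/
lemma rpow_lifespan_le {K σ t ε p : ℝ} (hK : 0 < K) (hσ : σ < 1) (hp : 1 < p) (ht : 1 ≤ t)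
    (hε : 0 < ε) (hε1 : ε ≤ 1) (h : K * lightDist σ t ≤ ε ^ (1 - p)) :
    t ≤ (1 + (1 - σ) / K) ^ (1 / (1 - σ)) * ε ^ (-(p - 1) / (1 - σ)) := by
  have hσ' : 0 < 1 - σ := by linarith
  have h1 : 1 ≤ ε ^ (1 - p) := Real.one_le_rpow_of_pos_of_le_one_of_nonpos hε hε1 (by linarith)
  have hq : 0 < (1 - σ) / K := by positivity
  refine (le_of_rpow_time_bound hK hσ ht h).trans ?_
  calc (1 + (1 - σ) / K * ε ^ (1 - p)) ^ (1 / (1 - σ))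
      ≤ ((1 + (1 - σ) / K) * ε ^ (1 - p)) ^ (1 / (1 - σ)) := by
        gcongr; linarith
    _ = _ := by
        rw [Real.mul_rpow (by positivity) (by positivity), ← Real.rpow_mul hε.le]
        congr 2; field_simp; ring

lemma exp_lifespan_le {K t y : ℝ} (hK : 0 < K) (ht : 1 ≤ t) (h : K * Real.log t ≤ y) :
    t ≤ Real.exp (1 / K * y) := by
  rw [← Real.log_le_iff_le_exp (by linarith), one_div, ← div_eq_inv_mul, le_div_iff₀ hK]
  linarith

lemma le_coe_of_forall_time_le {T : EReal} {B : ℝ} (hT : 1 < T)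
    (h : ∀ t : ℝ, 1 ≤ t → (t : EReal) < T → t ≤ B) : T ≤ (B : EReal) := by
  by_contra! hlt
  have hmax : ((max 1 B : ℝ) : EReal) < T := by
    rcases max_choice 1 B with e | e <;> rw [e]
    · exact_mod_cast hT
    · exact hlt
  obtain ⟨t, h1, h2⟩ := EReal.lt_iff_exists_real_btwn.1 hmax
  have h1' : max 1 B < t := by exact_mod_cast h1
  have := h t ((le_max_left _ _).trans h1'.le) h2
  linarith [le_max_right 1 B]

lemma lifespan_le {ε B : ℝ} (h : ∀ (T : EReal) (u : ℝ → Space n → ℝ),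
      IsClassicalSolution α μ p u₀ u₁ ε T u → ∀ t : ℝ, 1 ≤ t → (t : EReal) < T → t ≤ B) :
    lifespan α μ p u₀ u₁ ε ≤ (B : EReal) :=
  sSup_le fun T ⟨u, hu⟩ => le_coe_of_forall_time_le hu.one_lt (h T u hu)

lemma hasDerivAt_log_rpow {t : ℝ} (ht : 0 < t) : HasDerivAt Real.log (t ^ (-(1 : ℝ))) t := by
  rw [Real.rpow_neg_one]; exact Real.hasDerivAt_log ht.ne'

end Lifespan

/-! ### Critical exponents and conclusion -/

lemma criticalExponent_denom_pos {n : ℕ} (hn : 2 ≤ n) {α μ : ℝ} (hα₁ : α < 1)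
    (hμ : 0 ≤ μ) : 0 < (1 - α) * ((n : ℝ) - 1) + μ + α := by
  have h2 : (2 : ℝ) ≤ n := by exact_mod_cast hn
  nlinarith

lemma lt_one_of_lt_pG {n : ℕ} (hn : 2 ≤ n) {α μ p : ℝ} (hα₁ : α < 1)
    (hμ : 0 ≤ μ) (h : p < pG n α μ) : ((1 - α) * ((n : ℝ) - 1) + μ + α) * (p - 1) / 2 < 1 := by
  have hq := criticalExponent_denom_pos hn hα₁ hμ
  have h1 : p - 1 < 2 / ((1 - α) * ((n : ℝ) - 1) + μ + α) := by unfold pG at h; linarith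
  rw [lt_div_iff₀ hq] at h1
  linarith

lemma eq_one_of_eq_pG {n : ℕ} (hn : 2 ≤ n) {α μ p : ℝ} (hα₁ : α < 1)
    (hμ : 0 ≤ μ) (h : p = pG n α μ) : ((1 - α) * ((n : ℝ) - 1) + μ + α) * (p - 1) / 2 = 1 := by
  have hq := criticalExponent_denom_pos hn hα₁ hμ
  rw [h, pG]
  field_simp
  ring

lemma lt_one_of_lt_p0 {n : ℕ} (hn : 2 ≤ n) {α μ p : ℝ} (hα₁ : α < 1)
    (hμ : 0 ≤ μ) (h : p < p0 n α μ) : (p - 1) * ((n : ℝ) * (1 - α) + μ) < 1 := by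
  have hq : 0 < (n : ℝ) * (1 - α) + μ := by
    have h2 : (2 : ℝ) ≤ n := by exact_mod_cast hn
    have : 0 < 1 - α := by linarith
    positivity
  have h1 : p - 1 < 1 / ((n : ℝ) * (1 - α) + μ) := by unfold p0 at h; linarith
  rwa [lt_div_iff₀ hq] at h1

end Glassey

theorem theorem2p1 (n : ℕ) (hn : 2 ≤ n) (α μ p R : ℝ) (hα₀ : 0 ≤ α) (hα₁ : α < 1)
    (hμ : 0 ≤ μ) (hp : 1 < p) (hpc : p ≤ Glassey.pG n α μ ∨ p < Glassey.p0 n α μ) (hR : 0 < R)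
    (u₀ u₁ : Glassey.Space n → ℝ) (hu₀ : ContDiff ℝ 2 u₀) (hu₁ : ContDiff ℝ 1 u₁)
    (hnontriv : ¬ (u₀ = 0 ∧ u₁ = 0))
    (hsign : ∀ x, 0 ≤ u₀ x ∧ u₀ x ≤ u₁ x)
    (hsupp₀ : tsupport u₀ ⊆ Metric.closedBall 0 R)
    (hsupp₁ : tsupport u₁ ⊆ Metric.closedBall 0 R) :
    (∀ ε : ℝ, 0 < ε → ∀ (T : EReal) (u : ℝ → Glassey.Space n → ℝ),
      Glassey.IsClassicalSolution α μ p u₀ u₁ ε T u → T < ⊤) ∧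
    ∃ ε₀ : ℝ, 0 < ε₀ ∧ ∃ C : ℝ, 0 < C ∧ ∀ ε : ℝ, 0 < ε → ε ≤ ε₀ →
      (p < Glassey.pG n α μ →
        Glassey.lifespan α μ p u₀ u₁ ε ≤
          ((C * ε ^ (-(p - 1) /
            (1 - ((1 - α) * ((n : ℝ) - 1) + μ + α) * (p - 1) / 2)) : ℝ) : EReal)) ∧
      (p = Glassey.pG n α μ →
        Glassey.lifespan α μ p u₀ u₁ ε ≤ ((Real.exp (C * ε ^ (-(p - 1))) : ℝ) : EReal)) ∧
      (p < Glassey.p0 n α μ →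
        Glassey.lifespan α μ p u₀ u₁ ε ≤
          ((C * ε ^ (-(p - 1) / (1 - (p - 1) * ((n : ℝ) * (1 - α) + μ))) : ℝ) : EReal)) := by
  obtain ⟨K, hK, hexp⟩ := Glassey.exists_exponential_time_bound hn hα₀ hα₁ hμ hp hR hu₁.continuous
    hnontriv hsign hsupp₀ hsupp₁
  obtain ⟨K', hK', hplain⟩ := Glassey.exists_plain_time_bound hn hα₀ hα₁ hμ hp hR hu₁.continuous
    hnontriv hsign hsupp₀ hsupp₁
  set σ := ((1 - α) * ((n : ℝ) - 1) + μ + α) * (p - 1) / 2 with hσdef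
  set τ := (p - 1) * ((n : ℝ) * (1 - α) + μ) with hτdef
  have hσ : p < Glassey.pG n α μ → σ < 1 := Glassey.lt_one_of_lt_pG hn hα₁ hμ
  have hσ1 : p = Glassey.pG n α μ → σ = 1 := Glassey.eq_one_of_eq_pG hn hα₁ hμ
  have hτ : p < Glassey.p0 n α μ → τ < 1 := Glassey.lt_one_of_lt_p0 hn hα₁ hμ
  have bσ : p < Glassey.pG n α μ → ∀ ε : ℝ, 0 < ε → ∀ (T : EReal) (u : ℝ → Glassey.Space n → ℝ),
      Glassey.IsClassicalSolution α μ p u₀ u₁ ε T u → ∀ t : ℝ, 1 ≤ t → (t : EReal) < T →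
      K * Glassey.lightDist σ t ≤ ε ^ (1 - p) := fun h ε hε T u hu =>
    hexp ε hε T u hu _ (Glassey.lightDist_one σ) fun t ht =>
      Glassey.hasDerivAt_lightDist (hσ h).ne ht
  have bσ1 : p = Glassey.pG n α μ → ∀ ε : ℝ, 0 < ε → ∀ (T : EReal) (u : ℝ → Glassey.Space n → ℝ),
      Glassey.IsClassicalSolution α μ p u₀ u₁ ε T u → ∀ t : ℝ, 1 ≤ t → (t : EReal) < T →
      K * Real.log t ≤ ε ^ (1 - p) := fun h ε hε T u hu =>
    hexp ε hε T u hu _ Real.log_one fun t ht => by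
      rw [hσ1 h]; exact Glassey.hasDerivAt_log_rpow ht
  have bτ : p < Glassey.p0 n α μ → ∀ ε : ℝ, 0 < ε → ∀ (T : EReal) (u : ℝ → Glassey.Space n → ℝ),
      Glassey.IsClassicalSolution α μ p u₀ u₁ ε T u → ∀ t : ℝ, 1 ≤ t → (t : EReal) < T →
      K' * Glassey.lightDist τ t ≤ ε ^ (1 - p) := fun h ε hε T u hu =>
    hplain ε hε T u hu _ (Glassey.lightDist_one τ) fun t ht =>
      Glassey.hasDerivAt_lightDist (hτ h).ne ht
  refine ⟨fun ε hε T u hu => ?_, ?_⟩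
  -- Finiteness holds for every `ε`, so the bounds used here do not absorb the additive constant and
  -- need no smallness; `B` may depend on `ε`.
  · obtain ⟨B, hB⟩ : ∃ B : ℝ, ∀ t : ℝ, 1 ≤ t → (t : EReal) < T → t ≤ B := by
      rcases hpc with h | h
      · rcases h.lt_or_eq with h | h
        · exact ⟨_, fun t h1 h2 => Glassey.le_of_rpow_time_bound hK (hσ h) h1
            (bσ h ε hε T u hu t h1 h2)⟩
        · exact ⟨_, fun t h1 h2 => Glassey.exp_lifespan_le hK h1 (bσ1 h ε hε T u hu t h1 h2)⟩
      · exact ⟨_, fun t h1 h2 => Glassey.le_of_rpow_time_bound hK' (hτ h) h1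
          (bτ h ε hε T u hu t h1 h2)⟩
    exact (Glassey.le_coe_of_forall_time_le hu.one_lt hB).trans_lt (EReal.coe_lt_top B)
  -- One constant must serve all three cases, so it is a sum of three nonnegative ones. The default
  -- `1` only keeps the sum meaningful: each power bound is invoked under `σ < 1`, respectively `τ <
  -- 1`.
  · set C₁ := if σ < 1 then (1 + (1 - σ) / K) ^ (1 / (1 - σ)) else 1 with hC₁
    set C₂ := if τ < 1 then (1 + (1 - τ) / K') ^ (1 / (1 - τ)) else 1 with hC₂
    have hC₁0 : 0 ≤ C₁ := by
      rw [hC₁]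
      split_ifs with h
      · have : 0 ≤ 1 - σ := by linarith
        positivity
      · exact zero_le_one
    have hC₂0 : 0 ≤ C₂ := by
      rw [hC₂]
      split_ifs with h
      · have : 0 ≤ 1 - τ := by linarith
        positivity
      · exact zero_le_one
    refine ⟨1, one_pos, C₁ + 1 / K + C₂, by positivity, fun ε hε hε1 => ⟨fun h => ?_, fun h => ?_,
      fun h => ?_⟩⟩
    · refine Glassey.lifespan_le fun T u hu t h1 h2 => ?_
      refine (Glassey.rpow_lifespan_le hK (hσ h) hp h1 hε hε1 (bσ h ε hε T u hu t h1 h2)).trans ?_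
      gcongr
      rw [hC₁, if_pos (hσ h), add_assoc]
      exact le_add_of_nonneg_right (by positivity)
    · refine Glassey.lifespan_le fun T u hu t h1 h2 => ?_
      refine (Glassey.exp_lifespan_le hK h1 (bσ1 h ε hε T u hu t h1 h2)).trans ?_
      rw [neg_sub]
      gcongr
      linarith
    · refine Glassey.lifespan_le fun T u hu t h1 h2 => ?_
      refine (Glassey.rpow_lifespan_le hK' (hτ h) hp h1 hε hε1 (bτ h ε hε T u hu t h1 h2)).trans ?_
      gcongr
      rw [hC₂, if_pos (hτ h)]
      exact le_add_of_nonneg_left (by positivity)
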